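/- Let $d$ be a positive integer. Let $(T,o)$ be a unimodular random rooted tree, i.e. a random locally finite rooted tree such that, for every measurable $f\ge 0$ on the space of isomorphism classes of locally finite connected graphs with an ordered pair of roots (with its local topology), $$\mathbb{E}\sum_{v\in V(T)} f(T,o,v)=\mathbb{E}\sum_{v\in V(T)} f(T,v,o).$$ Suppose that almost surely every vertex of $T$ has degree in $\{2,3,\dots,d\}$. A line ensemble of a graph $G=(V,E)$ is a function $L:V^2\to\{0,1\}$ with $L(u,v)=L(v,u)$, with $L(u,v)=0$ unless $\{u,v\}\in E$, and with $\sum_{u}L(u,v)\in\{0,2\}$ for every $v\in V$; we write $v\in L$ if $\sum_u L(u,v)=2$. An invariant line ensemble of $(T,o)$ is a random $L$, defined on an enlarged probability space, that is almost surely a line ensemble of $T$ and for which the random rooted weighted graph $(T,L,o)$ is unimodular, i.e. satisfies the identity above for functions $f(T,L,u,v)$ of isomorphism classes of weighted graphs with two roots. Its density is $\mathbb{P}(o\in L)$. Then $(T,o)$ has an invariant line ensemble $L$ with $$\mathbb{P}(o\in L)\ \ge\ \frac13\,\frac{\mathbb{E}\deg(o)}{d},$$ and in fact, if $d\ge 6$,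 with $$\mathbb{P}(o\in L)\ \ge\ \frac13\,\frac{\mathbb{E}\deg(o)}{d-4}.$$ -/

import Mathlib

open MeasureTheory
open scoped ENNReal

/-- A locally finite connected weighted graph `(G, ω)` on a nonempty vertex set `V`. The weights
take values in `M` and vanish on pairs of distinct non-adjacent vertices. Integer-weighted graphs
are obtained for `M = ℤ`, and graphs without weights for the one-point set `M = Unit`. -/
structure Network (M : Type) [Zero M] where
  V : Type
  graph : SimpleGraph V
  connected : graph.Connected
  locallyFinite : ∀ v, (graph.neighborSet v).Finite
  weight : V → V → M
  weight_eq_zero : ∀ u v, u ≠ v → ¬ graph.Adj u v → weight u v = 0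

namespace Network

variable {M : Type} [Zero M]

/-- The degree of a vertex. -/
noncomputable def degree (N : Network M) (v : N.V) : ℕ := (N.graph.neighborSet v).ncard

/-- The vertices at graph distance at most `t` from `o`. -/
def ball (N : Network M) (o : N.V) (t : ℕ) : Set N.V := {v | N.graph.dist o v ≤ t}

/-- A bijection `e` between a set of vertices of `N` and a set of vertices of `N'` is an
isomorphism of the induced weighted graphs. -/
def IsInducedIso {N N' : Network M} {A : Set N.V} {B : Set N'.V} (e : A ≃ B) : Prop :=
  (∀ u v : A, N.graph.Adj u v ↔ N'.graph.Adj (e u) (e v)) ∧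
    ∀ u v : A, N.weight u v = N'.weight (e u) (e v)

/-- A bijection `e` between the vertex sets is an isomorphism of weighted graphs. -/
def IsIso {N N' : Network M} (e : N.V ≃ N'.V) : Prop :=
  (∀ u v, N.graph.Adj u v ↔ N'.graph.Adj (e u) (e v)) ∧
    ∀ u v, N.weight u v = N'.weight (e u) (e v)

theorem IsIso.refl (N : Network M) : IsIso (N := N) (N' := N) (Equiv.refl N.V) :=
  ⟨fun _ _ => Iff.rfl, fun _ _ => rfl⟩

theorem IsIso.symm {N N' : Network M} {e : N.V ≃ N'.V} (h : IsIso e) :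
    IsIso (N := N') (N' := N) e.symm :=
  ⟨fun u v => by simp [h.1], fun u v => by simp [h.2]⟩

theorem IsIso.trans {N N' N'' : Network M} {e : N.V ≃ N'.V} {e' : N'.V ≃ N''.V}
    (h : IsIso e) (h' : IsIso e') : IsIso (N := N) (N' := N'') (e.trans e') :=
  ⟨fun u v => by simp [h.1, h'.1], fun u v => by simp [h.2, h'.2]⟩

/-- The underlying graph, without the weights. -/
def forget (N : Network M) : Network Unit where
  V := N.V
  graph := N.graph
  connected := N.connected
  locallyFinite := N.locallyFinite
  weight := fun _ _ => ()
  weight_eq_zero := fun _ _ _ _ => rfl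

/-- The weights `L = N.weight` form a line ensemble of the underlying graph: they take values in
`{0, 1}`, they are edge-symmetric, and the weights at every vertex add up to `0` or `2`. (The sum
has only finitely many nonzero terms.) -/
def IsLineEnsemble (N : Network ℤ) : Prop :=
  (∀ u v, N.weight u v = 0 ∨ N.weight u v = 1) ∧
  (∀ u v, N.weight u v = N.weight v u) ∧
  (∀ u, N.weight u u = 0) ∧
  ∀ v, (∑ᶠ u, N.weight u v) = 0 ∨ (∑ᶠ u, N.weight u v) = 2

theorem IsIso.degree_eq {N N' : Network M} {e : N.V ≃ N'.V} (h : IsIso e) (v : N.V) :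
    N.degree v = N'.degree (e v) := by
  have himg : e '' N.graph.neighborSet v = N'.graph.neighborSet (e v) := by
    ext w
    constructor
    · rintro ⟨u, hu, rfl⟩
      exact (h.1 v u).1 hu
    · intro hw
      refine ⟨e.symm w, (h.1 _ _).2 ?_, by simp⟩
      simpa using hw
  unfold degree
  rw [← himg, Set.ncard_image_of_injective _ e.injective]

theorem IsIso.isTree {N N' : Network M} {e : N.V ≃ N'.V} (h : IsIso e)
    (hT : N.graph.IsTree) : N'.graph.IsTree := by
  have i : N.graph ≃g N'.graph := ⟨e, fun {a b} => (h.1 a b).symm⟩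
  exact i.isTree_iff.1 hT

theorem IsIso.isLineEnsemble {N N' : Network ℤ} {e : N.V ≃ N'.V} (h : IsIso e)
    (hL : N.IsLineEnsemble) : N'.IsLineEnsemble := by
  obtain ⟨h1, h2, h3, h4⟩ := hL
  have hw : ∀ u v, N'.weight u v = N.weight (e.symm u) (e.symm v) := fun u v => by
    rw [h.2]; simp
  refine ⟨fun u v => by rw [hw]; exact h1 _ _, fun u v => by rw [hw, hw v u]; exact h2 _ _,
    fun u => by rw [hw]; exact h3 _, fun v => ?_⟩
  have hs : (∑ᶠ u, N'.weight u v) = ∑ᶠ u, N.weight u (e.symm v) := by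
    rw [← finsum_comp_equiv e.symm]
    exact finsum_congr fun u => hw u v
  rw [hs]
  exact h4 _

end Network

/-- A rooted weighted graph `(G, ω, o)`. -/
structure RootedNetwork (M : Type) [Zero M] extends Network M where
  root : V

/-- A weighted graph `(G, ω, o, o')` with two roots. -/
structure BirootedNetwork (M : Type) [Zero M] extends Network M where
  root : V
  root' : V

/-- Isomorphism of rooted weighted graphs. -/
instance RootedNetwork.setoid (M : Type) [Zero M] : Setoid (RootedNetwork M) where
  r N N' := ∃ e : N.V ≃ N'.V,
    Network.IsIso (N := N.toNetwork) (N' := N'.toNetwork) e ∧ e N.root = N'.root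
  iseqv :=
    { refl := fun N => ⟨Equiv.refl _, Network.IsIso.refl _, rfl⟩
      symm := fun ⟨e, h, h'⟩ => ⟨e.symm, h.symm, by simp [← h']⟩
      trans := fun ⟨e, h, h'⟩ ⟨e₂, h₂, h₂'⟩ => ⟨e.trans e₂, h.trans h₂, by simp [h', h₂']⟩ }

/-- Isomorphism of weighted graphs with two roots. -/
instance BirootedNetwork.setoid (M : Type) [Zero M] : Setoid (BirootedNetwork M) where
  r N N' := ∃ e : N.V ≃ N'.V,
    Network.IsIso (N := N.toNetwork) (N' := N'.toNetwork) e ∧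
      e N.root = N'.root ∧ e N.root' = N'.root'
  iseqv :=
    { refl := fun N => ⟨Equiv.refl _, Network.IsIso.refl _, rfl, rfl⟩
      symm := fun ⟨e, h, h', h''⟩ => ⟨e.symm, h.symm, by simp [← h'], by simp [← h'']⟩
      trans := fun ⟨e, h, h', h''⟩ ⟨e₂, h₂, h₂', h₂''⟩ =>
        ⟨e.trans e₂, h.trans h₂, by simp [h', h₂'], by simp [h'', h₂'']⟩ }

/-- The set of unlabeled rooted weighted graphs. -/
def GStar (M : Type) [Zero M] : Type 1 := Quotient (RootedNetwork.setoid M)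

/-- The set of unlabeled weighted graphs with two roots. -/
def GStarStar (M : Type) [Zero M] : Type 1 := Quotient (BirootedNetwork.setoid M)

/-- The isomorphism class of a rooted weighted graph. -/
def GStar.mk {M : Type} [Zero M] (N : RootedNetwork M) : GStar M := Quotient.mk _ N

/-- The isomorphism class of a weighted graph with two roots. -/
def GStarStar.mk {M : Type} [Zero M] (N : BirootedNetwork M) : GStarStar M := Quotient.mk _ N

/-- The rooted balls `(G, ω, o)_t` of `N` and of `N'` are isomorphic. -/
def RootedNetwork.BallIso {M : Type} [Zero M] (t : ℕ) (N N' : RootedNetwork M) : Prop :=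
  ∃ e : N.toNetwork.ball N.root t ≃ N'.toNetwork.ball N'.root t,
    Network.IsInducedIso e ∧
      ∀ u : N.toNetwork.ball N.root t, (u : N.V) = N.root ↔ (e u : N'.V) = N'.root

/-- The balls of radius `t` around the first roots of `N` and of `N'` contain the second roots,
and are isomorphic as weighted graphs with two roots. -/
def BirootedNetwork.BallIso {M : Type} [Zero M] (t : ℕ) (N N' : BirootedNetwork M) : Prop :=
  N.root' ∈ N.toNetwork.ball N.root t ∧ N'.root' ∈ N'.toNetwork.ball N'.root t ∧
  ∃ e : N.toNetwork.ball N.root t ≃ N'.toNetwork.ball N'.root t,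
    Network.IsInducedIso e ∧
      (∀ u : N.toNetwork.ball N.root t, (u : N.V) = N.root ↔ (e u : N'.V) = N'.root) ∧
      ∀ u : N.toNetwork.ball N.root t, (u : N.V) = N.root' ↔ (e u : N'.V) = N'.root'

/-- The local topology: generated by the events that the ball of radius `t` around the root is
isomorphic to a given one. -/
instance (M : Type) [Zero M] : TopologicalSpace (GStar M) :=
  TopologicalSpace.generateFrom
    {s | ∃ (t : ℕ) (N : RootedNetwork M),
      s = {x : GStar M | ∃ N' : RootedNetwork M, x = GStar.mk N' ∧ N'.BallIso t N}}

/-- The local topology for weighted graphs with two roots. -/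
instance (M : Type) [Zero M] : TopologicalSpace (GStarStar M) :=
  TopologicalSpace.generateFrom
    {s | ∃ (t : ℕ) (N : BirootedNetwork M),
      s = {x : GStarStar M | ∃ N' : BirootedNetwork M, x = GStarStar.mk N' ∧ N'.BallIso t N}}

instance (M : Type) [Zero M] : MeasurableSpace (GStar M) := borel _

instance (M : Type) [Zero M] : MeasurableSpace (GStarStar M) := borel _

namespace GStar

variable {M : Type} [Zero M]

/-- `∑ v, f (G, o, v)`. -/
noncomputable def massOut (f : GStarStar M → ℝ≥0∞) : GStar M → ℝ≥0∞ :=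
  Quotient.lift
    (fun N : RootedNetwork M => ∑' v : N.V, f (GStarStar.mk ⟨N.toNetwork, N.root, v⟩))
    (by
      rintro N N' ⟨e, he, hr⟩
      rw [← Equiv.tsum_eq e]
      exact tsum_congr fun v => congrArg f (Quotient.sound ⟨e, he, hr, rfl⟩))

/-- `∑ v, f (G, v, o)`. -/
noncomputable def massIn (f : GStarStar M → ℝ≥0∞) : GStar M → ℝ≥0∞ :=
  Quotient.lift
    (fun N : RootedNetwork M => ∑' v : N.V, f (GStarStar.mk ⟨N.toNetwork, v, N.root⟩))
    (by
      rintro N N' ⟨e, he, hr⟩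
      rw [← Equiv.tsum_eq e]
      exact tsum_congr fun v => congrArg f (Quotient.sound ⟨e, he, rfl, hr⟩))

/-- A probability measure on unlabeled rooted weighted graphs is unimodular. -/
def IsUnimodular (ρ : Measure (GStar M)) : Prop :=
  IsProbabilityMeasure ρ ∧
    ∀ f : GStarStar M → ℝ≥0∞, Measurable f → ∫⁻ x, massOut f x ∂ρ = ∫⁻ x, massIn f x ∂ρ

/-- The unlabeled rooted graph obtained by dropping the weights. -/
def forget : GStar M → GStar Unit :=
  Quotient.lift (fun N : RootedNetwork M => GStar.mk ⟨N.toNetwork.forget, N.root⟩)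
    (by
      rintro N N' ⟨e, he, hr⟩
      exact Quotient.sound ⟨e, ⟨he.1, fun _ _ => rfl⟩, hr⟩)

/-- The degree of the root. -/
noncomputable def rootDegree : GStar M → ℕ :=
  Quotient.lift (fun N : RootedNetwork M => N.toNetwork.degree N.root)
    (by
      rintro N N' ⟨e, he, hr⟩
      rw [← hr]
      exact he.degree_eq N.root)

/-- The graph is a tree. -/
def IsTree : GStar M → Prop :=
  Quotient.lift (fun N : RootedNetwork M => N.graph.IsTree)
    (by
      rintro N N' ⟨e, he, -⟩
      exact propext ⟨he.isTree, he.symm.isTree⟩)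

/-- All degrees lie in `{a, a + 1, …, b}`. -/
def DegreesIn (a b : ℕ) : GStar M → Prop :=
  Quotient.lift
    (fun N : RootedNetwork M => ∀ v, a ≤ N.toNetwork.degree v ∧ N.toNetwork.degree v ≤ b)
    (by
      rintro N N' ⟨e, he, -⟩
      refine propext ⟨fun h v => ?_, fun h v => ?_⟩
      · rw [he.symm.degree_eq v]; exact h _
      · rw [he.degree_eq v]; exact h _)

/-- The weights form a line ensemble. -/
def IsLineEnsemble : GStar ℤ → Prop :=
  Quotient.lift (fun N : RootedNetwork ℤ => N.toNetwork.IsLineEnsemble)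
    (by
      rintro N N' ⟨e, he, -⟩
      exact propext ⟨he.isLineEnsemble, he.symm.isLineEnsemble⟩)

/-- The root lies on an edge of weight `1`; for a line ensemble `L` this is the event `o ∈ L`. -/
def RootMem : GStar ℤ → Prop :=
  Quotient.lift (fun N : RootedNetwork ℤ => ∃ u, N.weight u N.root = 1)
    (by
      rintro N N' ⟨e, he, hr⟩
      refine propext ⟨fun ⟨u, hu⟩ => ⟨e u, ?_⟩, fun ⟨u, hu⟩ => ⟨e.symm u, ?_⟩⟩
      · rw [← hr, ← he.2]; exact hu
      · rw [he.2, hr]; simpa using hu)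

/-- `σ` is the law of `(G, L, o)` for an invariant line ensemble `L` of the random rooted graph
`(G, o)` with law `ρ`: the weighted graph `(G, L, o)` is unimodular, dropping the weights gives
back the law `ρ`, and `L` is almost surely a line ensemble. -/
def IsInvariantLineEnsemble (ρ : Measure (GStar Unit)) (σ : Measure (GStar ℤ)) : Prop :=
  IsUnimodular σ ∧ MeasurePreserving forget σ ρ ∧ ∀ᵐ x ∂σ, IsLineEnsemble x

/-- The density `ℙ(o ∈ L)`. -/
noncomputable def density (σ : Measure (GStar ℤ)) : ℝ := σ.real {x | RootMem x}

end GStar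

/-! Put `D = max d 3`. On a fixed tree, let each vertex `v` choose a random set of neighbours: with
probability `deg v / D` a uniform pair, otherwise nothing. A given neighbour is then chosen with
probability `(deg v / D) * (2 / deg v) = 2 / D`, which does not depend on `deg v`. So the two
endpoints of an edge agree on the probability that the edge is chosen, and the choices can be glued
along the tree: explore from a root, and let each vertex draw its set conditioned on whether its
parent has chosen the edge between them. Almost surely an edge is chosen by both endpoints or by
neither, so the chosen edges form a line ensemble, and `o` lies on it with probability `deg o / D`.
The density is therefore `E deg(o) / D`, which exceeds both required bounds: `D ≤ 3 * d`, and `D = d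
≤ 3 * (d - 4)` when `d ≥ 6`. Taking `D ≥ 3` keeps `1 - 2 / D` positive, so that conditioning on the
absence of an edge makes sense.

Invariance rests on `IsGood.linkLaw_eq`: the law of the choices is the same from every starting
root. For neighbouring roots this is detailed balance (`pairWeight_mul_condWeight`), since only the
factors of the two roots change.

The rest is measure theory on spaces of isomorphism classes. The law of the links in a ball of
radius `t` depends only on the ball of radius `t + 1` (`netLaw_cyl_eq`), which gives measurable
kernels from graphs to weighted graphs. Averaging a transport function `f` on weighted graphs over
the links gives a measurable transport function on graphs with two roots. By root independence the
averaging commutes with `massOut` and `massIn`, so unimodularity of `ρ` passes to the weighted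
graph. -/

namespace Network

variable {M : Type} [Zero M]

/-! ### Balls and their isomorphisms -/

theorem mem_ball (N : Network M) {o v : N.V} {t : ℕ} : v ∈ N.ball o t ↔ N.graph.dist o v ≤ t :=
  Iff.rfl

theorem self_mem_ball (N : Network M) (o : N.V) (t : ℕ) : o ∈ N.ball o t := by
  simp [ball]

theorem ball_mono (N : Network M) (o : N.V) {t t' : ℕ} (h : t ≤ t') : N.ball o t ⊆ N.ball o t' :=
  fun _ hv => le_trans hv h

theorem ball_subset_ball (N : Network M) {o v : N.V} {t R : ℕ} (h : N.graph.dist o v + t ≤ R) :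
    N.ball v t ⊆ N.ball o R :=
  fun _ hw => (N.connected.dist_triangle (v := v)).trans ((Nat.add_le_add_left hw _).trans h)

theorem mem_ball_succ_of_adj (N : Network M) {o v w : N.V} {t : ℕ} (hv : v ∈ N.ball o t)
    (h : N.graph.Adj v w) : w ∈ N.ball o (t + 1) := by
  have h1 := N.connected.dist_triangle (u := o) (v := v) (w := w)
  have h2 := SimpleGraph.dist_eq_one_iff_adj.2 h
  simp only [mem_ball] at hv ⊢
  omega

/-- Each vertex other than `o` has a neighbour which is closer to `o`. -/
theorem exists_adj_dist_succ (N : Network M) {o v : N.V} (h : v ≠ o) :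
    ∃ w, N.graph.Adj w v ∧ N.graph.dist o w + 1 = N.graph.dist o v := by
  obtain ⟨p, hp⟩ := N.connected.exists_walk_length_eq_dist v o
  cases p with
  | nil => exact absurd rfl h
  | @cons _ w _ hadj q =>
    refine ⟨w, hadj.symm, ?_⟩
    have h1 := SimpleGraph.dist_le q
    have h2 := N.connected.dist_triangle (u := v) (v := w) (w := o)
    have h3 := SimpleGraph.dist_eq_one_iff_adj.2 hadj
    rw [SimpleGraph.Walk.length_cons] at hp
    rw [SimpleGraph.dist_comm (u := o), SimpleGraph.dist_comm (u := o)]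
    omega

theorem ball_finite (N : Network M) (o : N.V) (t : ℕ) : (N.ball o t).Finite := by
  induction t with
  | zero =>
    refine (Set.finite_singleton o).subset fun v hv => ?_
    have : N.graph.dist o v = 0 := Nat.le_zero.1 hv
    exact ((N.connected.dist_eq_zero_iff).1 this).symm
  | succ t ih =>
    refine (ih.union (ih.biUnion fun v _ => N.locallyFinite v)).subset fun v hv => ?_
    by_cases hvo : v = o
    · exact Or.inl (hvo ▸ N.self_mem_ball o t)
    obtain ⟨w, hw, hd⟩ := N.exists_adj_dist_succ hvo
    refine Or.inr (Set.mem_biUnion (x := w) ?_ hw)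
    simp only [mem_ball] at hv ⊢
    omega

instance (N : Network M) (o : N.V) (t : ℕ) : Finite (N.ball o t) := N.ball_finite o t

instance (N : Network M) : Countable N.V := by
  obtain ⟨o⟩ := N.connected.nonempty
  have : (Set.univ : Set N.V) = ⋃ t, N.ball o t := by
    ext v
    simpa using ⟨N.graph.dist o v, N.mem_ball.2 le_rfl⟩
  rw [← Set.countable_univ_iff, this]
  exact Set.countable_iUnion fun t => (N.ball_finite o t).countable

theorem IsInducedIso.symm {N N' : Network M} {A : Set N.V} {B : Set N'.V} {e : A ≃ B}
    (h : IsInducedIso e) : IsInducedIso (N := N') (N' := N) e.symm :=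
  ⟨fun u v => by simp [h.1], fun u v => by simp [h.2]⟩

theorem IsInducedIso.trans {N N' N'' : Network M} {A : Set N.V} {B : Set N'.V} {C : Set N''.V}
    {e : A ≃ B} {e' : B ≃ C} (h : IsInducedIso e) (h' : IsInducedIso e') :
    IsInducedIso (N := N) (N' := N'') (e.trans e') :=
  ⟨fun u v => by simp [h.1, h'.1], fun u v => by simp [h.2, h'.2]⟩

/-- A geodesic from `v` to `w` of length at most `n` stays in the ball, by the bound on `dist o v +
n`, so `e` carries it to a walk of the same length. Distances between points near the boundary need
not be preserved, because a geodesic may leave the ball. -/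
theorem IsInducedIso.dist_le {N N' : Network M} {o : N.V} {o' : N'.V} {R : ℕ}
    {e : N.ball o R ≃ N'.ball o' R} (h : IsInducedIso e) (v : N.ball o R) (n : ℕ)
    (hn : N.graph.dist o v + n ≤ R) (w : N.ball o R) (hw : N.graph.dist v w ≤ n) :
    N'.graph.dist (e v) (e w) ≤ n := by
  induction n generalizing w with
  | zero =>
    have : (v : N.V) = w := (N.connected.dist_eq_zero_iff).1 (Nat.le_zero.1 hw)
    rw [Subtype.ext this, SimpleGraph.dist_self]
  | succ n ih =>
    by_cases hvw : (w : N.V) = v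
    · rw [Subtype.ext hvw, SimpleGraph.dist_self]
      exact Nat.zero_le _
    obtain ⟨x, hx, hd⟩ := N.exists_adj_dist_succ hvw
    have hxb : x ∈ N.ball o R := by
      have := N.connected.dist_triangle (u := o) (v := v) (w := x)
      simp only [mem_ball]
      omega
    have h1 := ih (by omega) ⟨x, hxb⟩ (by simpa using by omega)
    have h2 := SimpleGraph.dist_eq_one_iff_adj.2 ((h.1 ⟨x, hxb⟩ w).1 hx)
    have h3 := N'.connected.dist_triangle (u := (e v : N'.V)) (v := e ⟨x, hxb⟩) (w := e w)
    omega

/-- An isomorphism `e` of rooted balls of radius `R`. -/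
structure IsBallIso {N N' : Network M} {o : N.V} {o' : N'.V} {R : ℕ}
    (e : N.ball o R ≃ N'.ball o' R) : Prop where
  induced : IsInducedIso e
  root : (e ⟨o, N.self_mem_ball o R⟩ : N'.V) = o'

namespace IsBallIso

variable {N N' N'' : Network M} {o : N.V} {o' : N'.V} {o'' : N''.V} {R : ℕ}
  {e : N.ball o R ≃ N'.ball o' R}

theorem symm (h : IsBallIso e) : IsBallIso e.symm := by
  refine ⟨h.induced.symm, ?_⟩
  have : (⟨o', N'.self_mem_ball o' R⟩ : N'.ball o' R) = e ⟨o, N.self_mem_ball o R⟩ :=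
    Subtype.ext h.root.symm
  rw [this, Equiv.symm_apply_apply]

theorem trans {e' : N'.ball o' R ≃ N''.ball o'' R} (h : IsBallIso e) (h' : IsBallIso e') :
    IsBallIso (e.trans e') := by
  refine ⟨h.induced.trans h'.induced, ?_⟩
  have : e ⟨o, N.self_mem_ball o R⟩ = ⟨o', N'.self_mem_ball o' R⟩ := Subtype.ext h.root
  simp [this, h'.root]

theorem dist_root_le (h : IsBallIso e) (v : N.ball o R) :
    N'.graph.dist o' (e v) ≤ N.graph.dist o v := by
  have := h.induced.dist_le ⟨o, N.self_mem_ball o R⟩ (N.graph.dist o v)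
    ((Nat.add_comm _ _).le.trans (by simpa using N.mem_ball.1 v.2)) v le_rfl
  rwa [h.root] at this

theorem dist_root (h : IsBallIso e) (v : N.ball o R) :
    N'.graph.dist o' (e v) = N.graph.dist o v := by
  refine le_antisymm (h.dist_root_le v) ?_
  simpa using h.symm.dist_root_le (e v)

/-- Restriction of an isomorphism of balls to a smaller ball, with another centre. -/
theorem exists_restrict (h : IsBallIso e) (v : N.ball o R) {t : ℕ}
    (ht : N.graph.dist o v + t ≤ R) :
    ∃ e' : N.ball v t ≃ N'.ball (e v) t, IsBallIso e' ∧
      ∀ u : N.ball v t, (e' u : N'.V) = e ⟨u, N.ball_subset_ball ht u.2⟩ := by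
  have ht' : N'.graph.dist o' (e v) + t ≤ R := by rwa [h.dist_root]
  refine ⟨⟨fun u => ⟨e ⟨u, N.ball_subset_ball ht u.2⟩, ?_⟩,
    fun u => ⟨e.symm ⟨u, N'.ball_subset_ball ht' u.2⟩, ?_⟩, fun u => ?_, fun u => ?_⟩,
    ⟨⟨fun a b => h.induced.1 ⟨a, _⟩ ⟨b, _⟩, fun a b => h.induced.2 ⟨a, _⟩ ⟨b, _⟩⟩, ?_⟩, fun u => rfl⟩
  · exact h.induced.dist_le v t ht _ u.2
  · have := h.symm.induced.dist_le (e v) t ht' ⟨u, N'.ball_subset_ball ht' u.2⟩ u.2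
    rwa [Equiv.symm_apply_apply] at this
  · simp
  · simp
  · rfl

theorem adj_iff (h : IsBallIso e) (u v : N.ball o R) :
    N.graph.Adj u v ↔ N'.graph.Adj (e u) (e v) :=
  h.induced.1 u v

/-- Strictly inside the ball all neighbours are present; on the boundary sphere some may be cut off,
hence the `+ 1`. -/
theorem image_neighborSet (h : IsBallIso e) (v : N.ball o R) (hv : N.graph.dist o v + 1 ≤ R) :
    ((↑) ∘ e) '' {u : N.ball o R | N.graph.Adj v u} = N'.graph.neighborSet (e v) := by
  ext w
  constructor
  · rintro ⟨u, hu, rfl⟩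
    exact (h.adj_iff v u).1 hu
  · intro hw
    have hwb : w ∈ N'.ball o' R := N'.ball_mono o' (by rwa [h.dist_root])
      (N'.mem_ball_succ_of_adj (N'.mem_ball.2 le_rfl) hw)
    refine ⟨e.symm ⟨w, hwb⟩, (h.adj_iff _ _).2 ?_, by simp⟩
    simpa using hw

theorem degree_eq (h : IsBallIso e) (v : N.ball o R) (hv : N.graph.dist o v + 1 ≤ R) :
    N'.degree (e v) = N.degree v := by
  have hN : N.graph.neighborSet v = (↑) '' {u : N.ball o R | N.graph.Adj v u} := by
    ext w
    simp only [SimpleGraph.mem_neighborSet, Set.mem_image, Subtype.exists]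
    exact ⟨fun hw => ⟨w, N.ball_mono o hv (N.mem_ball_succ_of_adj (N.mem_ball.2 le_rfl) hw), hw,
      rfl⟩, fun ⟨_, _, hw, h⟩ => h ▸ hw⟩
  rw [degree, degree, ← h.image_neighborSet v hv, hN,
    Set.ncard_image_of_injective _ (Subtype.val_injective.comp e.injective),
    Set.ncard_image_of_injective _ Subtype.val_injective]

end IsBallIso

end Network

/-! ### Ball isomorphism as an equivalence relation -/

section BallIso

variable {M : Type} [Zero M]

theorem Equiv.val_eq_iff {α β : Type*} {A : Set α} {B : Set β} (e : A ≃ B) {x : A} {y : β}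
    (h : (e x : β) = y) (u : A) : (u : α) = x ↔ (e u : β) = y := by
  rw [← h, ← Subtype.ext_iff, ← Subtype.ext_iff, e.apply_eq_iff_eq]

theorem Network.IsIso.dist_le {N N' : Network M} {e : N.V ≃ N'.V} (h : Network.IsIso e)
    (u v : N.V) : N'.graph.dist (e u) (e v) ≤ N.graph.dist u v := by
  obtain ⟨p, hp⟩ := N.connected.exists_walk_length_eq_dist u v
  let f : N.graph →g N'.graph := ⟨e, fun {a b} hab => (h.1 a b).1 hab⟩
  rw [← hp, ← SimpleGraph.Walk.length_map f p]
  exact SimpleGraph.dist_le _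

theorem Network.IsIso.dist_eq {N N' : Network M} {e : N.V ≃ N'.V} (h : Network.IsIso e)
    (u v : N.V) : N'.graph.dist (e u) (e v) = N.graph.dist u v := by
  refine le_antisymm (h.dist_le u v) ?_
  simpa using h.symm.dist_le (e u) (e v)

theorem Network.IsIso.exists_isBallIso {N N' : Network M} {e : N.V ≃ N'.V} (h : Network.IsIso e)
    (o : N.V) (t : ℕ) : ∃ e' : N.ball o t ≃ N'.ball (e o) t, Network.IsBallIso e' ∧
      ∀ u, (e' u : N'.V) = e u :=
  ⟨e.subtypeEquiv fun u => by simp [Network.mem_ball, h.dist_eq],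
    ⟨⟨fun u v => h.1 u v, fun u v => h.2 u v⟩, rfl⟩, fun _ => rfl⟩

namespace BirootedNetwork

theorem ballIso_iff {t : ℕ} {N N' : BirootedNetwork M} :
    N.BallIso t N' ↔ ∃ h : N.root' ∈ N.toNetwork.ball N.root t,
      ∃ e : N.toNetwork.ball N.root t ≃ N'.toNetwork.ball N'.root t,
        Network.IsBallIso e ∧ (e ⟨N.root', h⟩ : N'.V) = N'.root' := by
  constructor
  · rintro ⟨h, -, e, he, h1, h2⟩
    exact ⟨h, e, ⟨he, (h1 ⟨N.root, _⟩).1 rfl⟩, (h2 ⟨N.root', _⟩).1 rfl⟩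
  · rintro ⟨h, e, he, h'⟩
    refine ⟨h, h' ▸ (e ⟨N.root', h⟩).2, e, he.induced, e.val_eq_iff he.root,
      e.val_eq_iff h'⟩

theorem BallIso.symm {t : ℕ} {N N' : BirootedNetwork M} (h : N.BallIso t N') :
    N'.BallIso t N := by
  obtain ⟨h1, e, he, h2⟩ := ballIso_iff.1 h
  refine ballIso_iff.2 ⟨h2 ▸ (e _).2, e.symm, he.symm, ?_⟩
  simp_rw [← h2]
  simp

theorem BallIso.trans {t : ℕ} {N N' N'' : BirootedNetwork M} (h : N.BallIso t N')
    (h' : N'.BallIso t N'') : N.BallIso t N'' := by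
  obtain ⟨h1, e, he, h2⟩ := ballIso_iff.1 h
  obtain ⟨h1', e', he', h2'⟩ := ballIso_iff.1 h'
  refine ballIso_iff.2 ⟨h1, e.trans e', he.trans he', ?_⟩
  have : e ⟨N.root', h1⟩ = ⟨N'.root', h1'⟩ := Subtype.ext h2
  simp [this, h2']

theorem BallIso.mono {t t' : ℕ} (ht : t ≤ t') {N N' : BirootedNetwork M} (h : N.BallIso t' N')
    (hr : N.root' ∈ N.toNetwork.ball N.root t) : N.BallIso t N' := by
  obtain ⟨h1, e, he, h2⟩ := ballIso_iff.1 h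
  obtain ⟨e', he', h'⟩ := he.exists_restrict ⟨N.root, N.self_mem_ball N.root t'⟩ (t := t)
    (by simpa using ht)
  -- The centre of the target ball equals `N'.root` only propositionally, so `e'` is reverted to let
  -- its type be rewritten.
  revert e'
  rw [he.root]
  exact fun e' he' h' => ballIso_iff.2 ⟨hr, e', he', (h' _).trans h2⟩

theorem ballIso_of_equiv {t : ℕ} {N N' : BirootedNetwork M} (h : N ≈ N')
    (hr : N.root' ∈ N.toNetwork.ball N.root t) : N.BallIso t N' := by
  obtain ⟨e, he, h1, h2⟩ := h
  obtain ⟨e', he', h'⟩ := he.exists_isBallIso N.root t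
  revert e'
  rw [h1]
  exact fun e' he' h' => ballIso_iff.2 ⟨hr, e', he', (h' _).trans h2⟩

/-- The same weighted graph, with its two roots exchanged. -/
def swap (N : BirootedNetwork M) : BirootedNetwork M := ⟨N.toNetwork, N.root', N.root⟩

/-- The radius doubles because the ball of radius `t` around the second root lies only in the ball
of radius `t + t` around the first. -/
theorem BallIso.swap {t : ℕ} {N N' : BirootedNetwork M} (h : N.BallIso (t + t) N')
    (hr : N.root' ∈ N.toNetwork.ball N.root t) : N.swap.BallIso t N'.swap := by
  obtain ⟨h1, e, he, h2⟩ := ballIso_iff.1 h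
  obtain ⟨e', he', h'⟩ := he.exists_restrict ⟨N.root', h1⟩ (t := t)
    (Nat.add_le_add_right hr _)
  have hr' : N.root ∈ N.toNetwork.ball N.root' t := by
    rwa [Network.mem_ball, SimpleGraph.dist_comm]
  revert e'
  rw [h2]
  exact fun e' he' h' => ballIso_iff.2 ⟨hr', e', he', (h' ⟨_, hr'⟩).trans he.root⟩

end BirootedNetwork

namespace RootedNetwork

/-- The weighted graph `N`, with a second root equal to the first one. -/
def diag (N : RootedNetwork M) : BirootedNetwork M := ⟨N.toNetwork, N.root, N.root⟩

theorem ballIso_iff {t : ℕ} {N N' : RootedNetwork M} :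
    N.BallIso t N' ↔ ∃ e : N.toNetwork.ball N.root t ≃ N'.toNetwork.ball N'.root t,
        Network.IsBallIso e := by
  constructor
  · rintro ⟨e, he, h1⟩
    exact ⟨e, he, (h1 ⟨N.root, _⟩).1 rfl⟩
  · rintro ⟨e, he⟩
    refine ⟨e, he.induced, e.val_eq_iff he.root⟩

theorem ballIso_diag {t : ℕ} {N N' : RootedNetwork M} :
    N.diag.BallIso t N'.diag ↔ N.BallIso t N' := by
  rw [BirootedNetwork.ballIso_iff, ballIso_iff]
  constructor
  · rintro ⟨-, e, he, -⟩
    exact ⟨e, he⟩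
  · rintro ⟨e, he⟩
    exact ⟨N.self_mem_ball N.root t, e, he, he.root⟩

theorem BallIso.symm {t : ℕ} {N N' : RootedNetwork M} (h : N.BallIso t N') : N'.BallIso t N :=
  ballIso_diag.1 (ballIso_diag.2 h).symm

theorem BallIso.trans {t : ℕ} {N N' N'' : RootedNetwork M} (h : N.BallIso t N')
    (h' : N'.BallIso t N'') : N.BallIso t N'' :=
  ballIso_diag.1 ((ballIso_diag.2 h).trans (ballIso_diag.2 h'))

theorem BallIso.mono {t t' : ℕ} (ht : t ≤ t') {N N' : RootedNetwork M} (h : N.BallIso t' N') :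
    N.BallIso t N' :=
  ballIso_diag.1 ((ballIso_diag.2 h).mono ht (N.self_mem_ball N.root t))

theorem ballIso_of_equiv {t : ℕ} {N N' : RootedNetwork M} (h : N ≈ N') : N.BallIso t N' := by
  obtain ⟨e, he, h1⟩ := h
  exact ballIso_diag.1 (BirootedNetwork.ballIso_of_equiv ⟨e, he, h1, h1⟩
    (N.self_mem_ball N.root t))

theorem BallIso.refl {t : ℕ} (N : RootedNetwork M) : N.BallIso t N :=
  ballIso_of_equiv (Setoid.refl N)

end RootedNetwork

end BallIso

/-! ### The local topology and measurability of mass transport -/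

section LocalTopology

variable {M : Type} [Zero M]

namespace GStarStar

/-- The set of graphs whose ball of radius `t` looks like that of `N`. -/
def cyl (t : ℕ) (N : BirootedNetwork M) : Set (GStarStar M) :=
  {x | ∃ N' : BirootedNetwork M, x = GStarStar.mk N' ∧ N'.BallIso t N}

theorem mk_eq_mk {N N' : BirootedNetwork M} : mk N = mk N' ↔ N ≈ N' := Quotient.eq

theorem mk_mem_cyl {t : ℕ} {N N' : BirootedNetwork M} : mk N' ∈ cyl t N ↔ N'.BallIso t N := by
  constructor
  · rintro ⟨N₁, h, h'⟩
    have h2 := mk_eq_mk.1 h.symm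
    have := BirootedNetwork.ballIso_of_equiv (t := t) h2 h'.1
    exact this.symm.trans h'
  · exact fun h => ⟨N', rfl, h⟩

theorem ind {p : GStarStar M → Prop} (h : ∀ N, p (mk N)) (x : GStarStar M) : p x :=
  Quotient.ind h x

theorem exists_mk (x : GStarStar M) : ∃ N, mk N = x := Quotient.exists_rep x

theorem isOpen_cyl (t : ℕ) (N : BirootedNetwork M) : IsOpen (cyl t N) :=
  TopologicalSpace.isOpen_generateFrom_of_mem ⟨t, N, rfl⟩

theorem isOpen_of_local {U : Set (GStarStar M)}
    (h : ∀ N, mk N ∈ U → ∃ t, N.root' ∈ N.toNetwork.ball N.root t ∧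
      ∀ N', N'.BallIso t N → mk N' ∈ U) : IsOpen U := by
  refine isOpen_iff_forall_mem_open.2 (ind fun N hN => ?_)
  obtain ⟨t, ht, h'⟩ := h N hN
  refine ⟨cyl t N, ind fun N' hN' => h' N' (mk_mem_cyl.1 hN'), isOpen_cyl t N,
    mk_mem_cyl.2 (BirootedNetwork.ballIso_of_equiv (Setoid.refl N) ht)⟩

/-- The generating sets of the local topology. -/
def cyls (M : Type) [Zero M] : Set (Set (GStarStar M)) :=
  {s | ∃ (t : ℕ) (N : BirootedNetwork M), s = cyl t N}

/-- As for balls in an ultrametric space, two cylinders are disjoint or nested: being isomorphic up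
to the larger radius implies it up to the smaller one. -/
theorem isPiSystem_cyls : IsPiSystem (cyls M) := by
  have key : ∀ (t t' : ℕ) (N N' : BirootedNetwork M), t ≤ t' → (cyl t N ∩ cyl t' N').Nonempty →
      cyl t N ∩ cyl t' N' = cyl t' N' := by
    rintro t t' N N' h ⟨x, hx⟩
    obtain ⟨N₁, rfl⟩ := exists_mk x
    obtain ⟨h1, h2⟩ := hx
    refine Set.inter_eq_right.2 (ind fun N₂ hN₂ => ?_)
    rw [mk_mem_cyl] at h1 h2 hN₂ ⊢
    exact (((h2.trans hN₂.symm).mono h h1.1).symm).trans h1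
  rintro _ ⟨t, N, rfl⟩ _ ⟨t', N', rfl⟩ hne
  rcases le_total t t' with h | h
  · exact ⟨t', N', key t t' N N' h hne⟩
  · rw [Set.inter_comm] at hne ⊢
    exact ⟨t, N, key t' t N' N h hne⟩

/-- A ball is finite, so once its vertices are numbered by `Fin n` it becomes one of countably many
tables of adjacencies, weights and roots, and this table determines the cylinder. Second
countability, and with it generation of the Borel sets by cylinders, follows. -/
theorem exists_code [Countable M] : ∃ (α : Type) (_ : Countable α) (c : ℕ × BirootedNetwork M → α),
    Function.FactorsThrough (fun a => cyl a.1 a.2) c := by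
  classical
  let C := Σ n : ℕ, (Fin n → Fin n → Prop) × (Fin n → Fin n → M) × Fin n × Fin n
  let φ : ∀ (t : ℕ) (N : BirootedNetwork M),
      N.toNetwork.ball N.root t ≃ Fin (Nat.card (N.toNetwork.ball N.root t)) :=
    fun t N => Finite.equivFin _
  let c : ℕ × BirootedNetwork M → ℕ × Option C := fun a =>
    (a.1, if h : a.2.root' ∈ a.2.toNetwork.ball a.2.root a.1 then
      some ⟨_, fun i j => a.2.graph.Adj ((φ a.1 a.2).symm i) ((φ a.1 a.2).symm j),
        fun i j => a.2.weight ((φ a.1 a.2).symm i) ((φ a.1 a.2).symm j),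
        φ a.1 a.2 ⟨a.2.root, a.2.self_mem_ball _ _⟩, φ a.1 a.2 ⟨a.2.root', h⟩⟩ else none)
  refine ⟨ℕ × Option C, inferInstance, c, ?_⟩
  rintro ⟨t, N⟩ ⟨t', N'⟩ h
  simp only [c, Prod.mk.injEq] at h
  obtain ⟨rfl, h⟩ := h
  have hempty : ∀ N : BirootedNetwork M, N.root' ∉ N.toNetwork.ball N.root t → cyl t N = ∅ :=
    fun N hN => Set.eq_empty_iff_forall_notMem.2 (ind fun N' hN' => hN (mk_mem_cyl.1 hN').2.1)
  by_cases h1 : N.root' ∈ N.toNetwork.ball N.root t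
  · by_cases h2 : N'.root' ∈ N'.toNetwork.ball N'.root t
    · rw [dif_pos h1, dif_pos h2, Option.some_inj] at h
      suffices hs : N.BallIso t N' by
        ext x
        obtain ⟨N₁, rfl⟩ := exists_mk x
        simp only [mk_mem_cyl]
        exact ⟨fun h => h.trans hs, fun h => h.trans hs.symm⟩
      generalize φ t N = ψ at h
      generalize φ t N' = ψ' at h
      generalize Nat.card (N.toNetwork.ball N.root t) = n at ψ h
      generalize Nat.card (N'.toNetwork.ball N'.root t) = n' at ψ' h
      obtain rfl : n = n' := congrArg Sigma.fst h
      have h := eq_of_heq (Sigma.mk.inj_iff.1 h).2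
      obtain ⟨ha, hw, hr, hr'⟩ : _ ∧ _ ∧ _ ∧ _ := by simpa only [Prod.mk.injEq] using h
      refine BirootedNetwork.ballIso_iff.2 ⟨h1, ψ.trans ψ'.symm, ⟨⟨fun u v => ?_, fun u v => ?_⟩,
        ?_⟩, ?_⟩
      · simpa using congrFun (congrFun ha (ψ u)) (ψ v)
      · simpa using congrFun (congrFun hw (ψ u)) (ψ v)
      · simp [hr]
      · simp [hr']
    · rw [dif_pos h1, dif_neg h2] at h
      simp at h
  · by_cases h2 : N'.root' ∈ N'.toNetwork.ball N'.root t
    · rw [dif_neg h1, dif_pos h2] at h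
      simp at h
    · change cyl t N = cyl t N'
      rw [hempty N h1, hempty N' h2]

theorem countable_cyls [Countable M] : (cyls M).Countable := by
  obtain ⟨α, _, c, hc⟩ := exists_code (M := M)
  refine (Set.countable_range (Function.extend c (fun a => cyl a.1 a.2) fun _ => ∅)).mono ?_
  rintro _ ⟨t, N, rfl⟩
  exact ⟨c (t, N), hc.extend_apply _ (t, N)⟩

instance [Countable M] : SecondCountableTopology (GStarStar M) := ⟨⟨cyls M, countable_cyls, rfl⟩⟩

instance : BorelSpace (GStarStar M) := ⟨rfl⟩

theorem generateFrom_cyls [Countable M] :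
    (inferInstance : MeasurableSpace (GStarStar M)) = .generateFrom (cyls M) :=
  borel_eq_generateFrom_of_subbasis rfl

theorem measurable_of_cyl [Countable M] {β : Type*} [MeasurableSpace β] {f : β → GStarStar M}
    (h : ∀ t N, MeasurableSet (f ⁻¹' cyl t N)) : Measurable f := by
  refine measurable_iff_le_map.2
    (generateFrom_cyls.le.trans (MeasurableSpace.generateFrom_le ?_))
  rintro _ ⟨t, N, rfl⟩
  exact h t N

end GStarStar

namespace GStar

/-- The set of graphs whose ball of radius `t` looks like that of `N`. -/
def cyl (t : ℕ) (N : RootedNetwork M) : Set (GStar M) :=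
  {x | ∃ N' : RootedNetwork M, x = GStar.mk N' ∧ N'.BallIso t N}

theorem mk_eq_mk {N N' : RootedNetwork M} : mk N = mk N' ↔ N ≈ N' := Quotient.eq

theorem mk_mem_cyl {t : ℕ} {N N' : RootedNetwork M} : mk N' ∈ cyl t N ↔ N'.BallIso t N := by
  constructor
  · rintro ⟨N₁, h, h'⟩
    exact (RootedNetwork.ballIso_of_equiv (mk_eq_mk.1 h)).trans h'
  · exact fun h => ⟨N', rfl, h⟩

theorem ind {p : GStar M → Prop} (h : ∀ N, p (mk N)) (x : GStar M) : p x :=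
  Quotient.ind h x

theorem exists_mk (x : GStar M) : ∃ N, mk N = x := Quotient.exists_rep x

theorem isOpen_cyl (t : ℕ) (N : RootedNetwork M) : IsOpen (cyl t N) :=
  TopologicalSpace.isOpen_generateFrom_of_mem ⟨t, N, rfl⟩

theorem isOpen_of_local {U : Set (GStar M)}
    (h : ∀ N, mk N ∈ U → ∃ t, ∀ N', N'.BallIso t N → mk N' ∈ U) : IsOpen U := by
  refine isOpen_iff_forall_mem_open.2 (ind fun N hN => ?_)
  obtain ⟨t, h'⟩ := h N hN
  exact ⟨cyl t N, ind fun N' hN' => h' N' (mk_mem_cyl.1 hN'), isOpen_cyl t N,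
    mk_mem_cyl.2 (.refl N)⟩

instance : BorelSpace (GStar M) := ⟨rfl⟩

/-- Such a `g` is locally constant, so the preimage of any set whatsoever is open. -/
theorem measurable_of_local {β : Type*} [MeasurableSpace β] {g : GStar M → β}
    (h : ∀ N, ∃ t, ∀ N', N'.BallIso t N → g (mk N') = g (mk N)) : Measurable g := by
  refine fun s _ => (isOpen_of_local fun N hN => ?_).measurableSet
  obtain ⟨t, ht⟩ := h N
  refine ⟨t, fun N' hN' => ?_⟩
  rw [Set.mem_preimage] at hN ⊢
  rwa [ht N' hN']

/-- The same graph, with the second root equal to the first one. -/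
def diag : GStar M → GStarStar M :=
  Quotient.lift (fun N : RootedNetwork M => GStarStar.mk N.diag)
    (by
      rintro N N' ⟨e, he, hr⟩
      exact Quotient.sound ⟨e, he, hr, hr⟩)

theorem diag_mk (N : RootedNetwork M) : diag (mk N) = GStarStar.mk N.diag := rfl

theorem continuous_diag : Continuous (diag : GStar M → GStarStar M) := by
  refine continuous_generateFrom_iff.2 ?_
  rintro _ ⟨t, N, rfl⟩
  refine isOpen_of_local fun N₁ hN₁ => ⟨t, fun N₂ h => ?_⟩
  exact GStarStar.mk_mem_cyl.2 ((RootedNetwork.ballIso_diag.2 h).trans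
    (GStarStar.mk_mem_cyl.1 hN₁))

end GStar

namespace GStarStar

/-- Forget the second root. -/
def fst : GStarStar M → GStar M :=
  Quotient.lift (fun N : BirootedNetwork M => GStar.mk ⟨N.toNetwork, N.root⟩)
    (by
      rintro N N' ⟨e, he, hr, -⟩
      exact Quotient.sound ⟨e, he, hr⟩)

theorem continuous_fst : Continuous (fst : GStarStar M → GStar M) := by
  refine continuous_generateFrom_iff.2 ?_
  rintro _ ⟨t, N, rfl⟩
  refine isOpen_of_local fun N₁ hN₁ =>
    ⟨max t (N₁.graph.dist N₁.root N₁.root'), N₁.mem_ball.2 (le_max_right _ _), fun N₂ h => ?_⟩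
  have h1 : RootedNetwork.BallIso t _ N := GStar.mk_mem_cyl.1 hN₁
  obtain ⟨-, e, he, -⟩ := BirootedNetwork.ballIso_iff.1 h
  have h2 : RootedNetwork.BallIso (max t (N₁.graph.dist N₁.root N₁.root'))
    ⟨N₂.toNetwork, N₂.root⟩ ⟨N₁.toNetwork, N₁.root⟩ := RootedNetwork.ballIso_iff.2 ⟨e, he⟩
  exact GStar.mk_mem_cyl.2 ((h2.mono (le_max_left _ _)).trans h1)

/-- Exchange the two roots. -/
def swap : GStarStar M → GStarStar M :=
  Quotient.lift (fun N : BirootedNetwork M => mk N.swap)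
    (by
      rintro N N' ⟨e, he, hr, hr'⟩
      exact Quotient.sound ⟨e, he, hr', hr⟩)

theorem continuous_swap : Continuous (swap : GStarStar M → GStarStar M) := by
  refine continuous_generateFrom_iff.2 ?_
  rintro _ ⟨t, N, rfl⟩
  refine isOpen_of_local fun N₁ hN₁ => ?_
  have h1 : N₁.swap.BallIso t N := mk_mem_cyl.1 hN₁
  have h2 : N₁.root' ∈ N₁.toNetwork.ball N₁.root t := by
    have := h1.1
    rwa [Network.mem_ball, SimpleGraph.dist_comm] at this
  refine ⟨t + t, N₁.ball_mono _ (Nat.le_add_left t t) h2, fun N₂ h => ?_⟩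
  exact mk_mem_cyl.2 ((h.symm.swap h2).symm.trans h1)

end GStarStar

namespace GStar

theorem continuous_forget : Continuous (forget : GStar M → GStar Unit) := by
  refine continuous_generateFrom_iff.2 ?_
  rintro _ ⟨t, N, rfl⟩
  refine isOpen_of_local fun N₁ hN₁ => ⟨t, fun N₂ h => ?_⟩
  obtain ⟨e, he⟩ := RootedNetwork.ballIso_iff.1 h
  have h1 : RootedNetwork.BallIso t _ N := mk_mem_cyl.1 hN₁
  have h2 : RootedNetwork.BallIso t ⟨N₂.forget, N₂.root⟩ ⟨N₁.forget, N₁.root⟩ :=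
    RootedNetwork.ballIso_iff.2 ⟨e, ⟨⟨he.induced.1, fun _ _ => rfl⟩, he.root⟩⟩
  exact mk_mem_cyl.2 (h2.trans h1)

/-- The counting measure on the second root, at distance `r` from the first one. -/
noncomputable def sphereMeasure (r : ℕ) (x : GStar M) : Measure (GStarStar M) :=
  Measure.sum fun v : {v : x.out.V // x.out.graph.dist x.out.root v = r} =>
    Measure.dirac (GStarStar.mk ⟨x.out.toNetwork, x.out.root, v⟩)

theorem tsum_sphere_congr {N N' : RootedNetwork M} {t r : ℕ} (hr : r ≤ t) (h : N.BallIso t N')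
    (f : GStarStar M → ℝ≥0∞)
    (hf : ∀ v v', BirootedNetwork.BallIso t ⟨N.toNetwork, N.root, v⟩ ⟨N'.toNetwork, N'.root, v'⟩ →
      f (.mk ⟨N.toNetwork, N.root, v⟩) = f (.mk ⟨N'.toNetwork, N'.root, v'⟩)) :
    ∑' v : {v : N.V // N.graph.dist N.root v = r}, f (.mk ⟨N.toNetwork, N.root, v⟩) =
      ∑' v : {v : N'.V // N'.graph.dist N'.root v = r}, f (.mk ⟨N'.toNetwork, N'.root, v⟩) := by
  obtain ⟨e, he⟩ := RootedNetwork.ballIso_iff.1 h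
  let φ : {v : N.V // N.graph.dist N.root v = r} ≃ {v : N'.V // N'.graph.dist N'.root v = r} :=
    { toFun := fun v => ⟨e ⟨v, N.mem_ball.2 (v.2.le.trans hr)⟩, (he.dist_root _).trans v.2⟩
      invFun := fun v => ⟨e.symm ⟨v, N'.mem_ball.2 (v.2.le.trans hr)⟩, (he.symm.dist_root _).trans v.2⟩
      left_inv := fun v => Subtype.ext (by simp)
      right_inv := fun v => Subtype.ext (by simp) }
  rw [← φ.tsum_eq]
  exact tsum_congr fun v => hf _ _ (BirootedNetwork.ballIso_iff.2 ⟨v.2.le.trans hr, e, he, rfl⟩)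

/-- Shows that the arbitrary representative `x.out` in `sphereMeasure` does not matter. -/
theorem tsum_sphere_of_equiv {N N' : RootedNetwork M} (r : ℕ) (h : N ≈ N')
    (f : GStarStar M → ℝ≥0∞) :
    ∑' v : {v : N.V // N.graph.dist N.root v = r}, f (.mk ⟨N.toNetwork, N.root, v⟩) =
      ∑' v : {v : N'.V // N'.graph.dist N'.root v = r}, f (.mk ⟨N'.toNetwork, N'.root, v⟩) := by
  obtain ⟨e, he, hr⟩ := h
  let φ : {v : N.V // N.graph.dist N.root v = r} ≃ {v : N'.V // N'.graph.dist N'.root v = r} :=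
    e.subtypeEquiv fun v => by rw [← hr, he.dist_eq]
  rw [← φ.tsum_eq]
  exact tsum_congr fun v => congrArg f (Quotient.sound ⟨e, he, hr, rfl⟩)

theorem lintegral_sphereMeasure (r : ℕ) (N : RootedNetwork M) {f : GStarStar M → ℝ≥0∞}
    (hf : Measurable f) :
    ∫⁻ y, f y ∂sphereMeasure r (mk N) =
      ∑' v : {v : N.V // N.graph.dist N.root v = r}, f (.mk ⟨N.toNetwork, N.root, v⟩) := by
  rw [sphereMeasure, lintegral_sum_measure]
  simp_rw [lintegral_dirac' _ hf]
  exact tsum_sphere_of_equiv r (Quotient.mk_out N) f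

theorem sphereMeasure_apply (r : ℕ) (N : RootedNetwork M) {s : Set (GStarStar M)}
    (hs : MeasurableSet s) :
    sphereMeasure r (mk N) s = ∑' v : {v : N.V // N.graph.dist N.root v = r},
      s.indicator 1 (GStarStar.mk ⟨N.toNetwork, N.root, v⟩) := by
  rw [← lintegral_indicator_one hs, lintegral_sphereMeasure r N (measurable_one.indicator hs)]

instance (r : ℕ) (x : GStar M) : IsFiniteMeasure (sphereMeasure r x) := by
  have : Finite {v : x.out.V // x.out.graph.dist x.out.root v = r} :=
    ((x.out.ball_finite x.out.root r).subset fun v (hv : _ = r) => hv.le).to_subtype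
  have := Fintype.ofFinite {v : x.out.V // x.out.graph.dist x.out.root v = r}
  refine ⟨?_⟩
  rw [sphereMeasure, Measure.sum_apply _ MeasurableSet.univ, tsum_fintype]
  simp

/-- The mass of a cylinder of radius `t` counts points of the sphere of radius `r`, and is read off
from the ball of radius `max r t`; hence it is locally constant. The measures are finite, so the
cylinders, a π-system, suffice. -/
theorem measurable_sphereMeasure [Countable M] (r : ℕ) :
    Measurable (sphereMeasure r : GStar M → Measure (GStarStar M)) := by
  refine .measure_of_isPiSystem GStarStar.generateFrom_cyls GStarStar.isPiSystem_cyls ?_ ?_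
  · rintro _ ⟨t, N₀, rfl⟩
    refine measurable_of_local fun N => ⟨max r t, fun N' h => ?_⟩
    have hm := (GStarStar.isOpen_cyl t N₀).measurableSet
    rw [sphereMeasure_apply r N' hm, sphereMeasure_apply r N hm]
    refine tsum_sphere_congr (le_max_left r t) h _ fun v v' hv => ?_
    have : GStarStar.mk ⟨N'.toNetwork, N'.root, v⟩ ∈ GStarStar.cyl t N₀ ↔
        GStarStar.mk ⟨N.toNetwork, N.root, v'⟩ ∈ GStarStar.cyl t N₀ := by
      simp only [GStarStar.mk_mem_cyl]
      exact ⟨fun h => (hv.mono (le_max_right r t) h.1).symm.trans h,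
        fun h => (hv.symm.mono (le_max_right r t) h.1).symm.trans h⟩
    by_cases h1 : GStarStar.mk ⟨N'.toNetwork, N'.root, v⟩ ∈ GStarStar.cyl t N₀
    · rw [Set.indicator_of_mem h1, Set.indicator_of_mem (this.1 h1)]; rfl
    · rw [Set.indicator_of_notMem h1, Set.indicator_of_notMem (this.not.1 h1)]
  · refine measurable_of_local fun N => ⟨r, fun N' h => ?_⟩
    rw [sphereMeasure_apply r N' .univ, sphereMeasure_apply r N .univ]
    exact tsum_sphere_congr le_rfl h _ fun v v' _ => by simp

theorem massOut_mk (f : GStarStar M → ℝ≥0∞) (N : RootedNetwork M) :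
    massOut f (mk N) = ∑' v : N.V, f (GStarStar.mk ⟨N.toNetwork, N.root, v⟩) := rfl

theorem massIn_mk (f : GStarStar M → ℝ≥0∞) (N : RootedNetwork M) :
    massIn f (mk N) = ∑' v : N.V, f (GStarStar.mk ⟨N.toNetwork, v, N.root⟩) := rfl

/-- Counting all vertices at once gives a possibly infinite measure; splitting by distance makes
each piece finite, as the π-system argument requires. -/
theorem massOut_eq_tsum {f : GStarStar M → ℝ≥0∞} (hf : Measurable f) (x : GStar M) :
    massOut f x = ∑' r, ∫⁻ y, f y ∂sphereMeasure r x := by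
  obtain ⟨N, rfl⟩ := exists_mk x
  simp_rw [lintegral_sphereMeasure _ N hf]
  rw [massOut_mk, ← (Equiv.sigmaFiberEquiv fun v => N.graph.dist N.root v).tsum_eq,
    ENNReal.tsum_sigma']
  rfl

theorem measurable_massOut [Countable M] {f : GStarStar M → ℝ≥0∞} (hf : Measurable f) :
    Measurable (massOut f) := by
  rw [funext (massOut_eq_tsum hf)]
  exact .tsum fun r => (Measure.measurable_lintegral hf).comp (measurable_sphereMeasure r)

theorem massIn_eq_massOut_swap (f : GStarStar M → ℝ≥0∞) :
    massIn f = massOut (f ∘ GStarStar.swap) :=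
  funext (ind fun _ => rfl)

theorem measurable_massIn [Countable M] {f : GStarStar M → ℝ≥0∞} (hf : Measurable f) :
    Measurable (massIn f) := by
  rw [massIn_eq_massOut_swap]
  exact measurable_massOut (hf.comp GStarStar.continuous_swap.measurable)

end GStar

end LocalTopology

/-! ### Random pairs of neighbours -/

section PairLaw

variable {α : Type*}

open Classical in
/-- The probability that the random set of links at a vertex with neighbours `s` is `A`: the set is
a uniform pair with probability `s.card / D`, and is empty otherwise. -/
noncomputable def pairWeight (D : ℕ) (s A : Finset α) : ℝ :=
  if A ⊆ s then
    if A.card = 0 then 1 - s.card / D else if A.card = 2 then 2 / (D * (s.card - 1)) else 0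
  else 0

open Classical in
/-- The probability that an edge is or is not a link. -/
noncomputable def edgeWeight (D : ℕ) (b : Prop) : ℝ := if b then 2 / D else 1 - 2 / D

open Classical in
/-- The law `pairWeight`, conditioned on whether `w` belongs to the random set. -/
noncomputable def condWeight (D : ℕ) (s : Finset α) (w : α) (b : Prop) (A : Finset α) : ℝ :=
  if (w ∈ A ↔ b) then pairWeight D s A / edgeWeight D b else 0

variable {D : ℕ} {s : Finset α}

/-- This is where `3 ≤ D` is needed: for `D = 2` every edge would be a link, and conditioning on its
absence would divide by zero. -/
theorem edgeWeight_pos (hD : 3 ≤ D) (b : Prop) : 0 < edgeWeight D b := by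
  have h : (3 : ℝ) ≤ D := by exact_mod_cast hD
  unfold edgeWeight
  split_ifs
  · positivity
  · rw [sub_pos, div_lt_one (by linarith)]
    linarith

theorem pairWeight_nonneg (h2 : 2 ≤ s.card) (hD : s.card ≤ D) (A : Finset α) :
    0 ≤ pairWeight D s A := by
  have h2 : (2 : ℝ) ≤ s.card := by exact_mod_cast h2
  have hD : (s.card : ℝ) ≤ D := by exact_mod_cast hD
  unfold pairWeight
  split_ifs
  · rw [sub_nonneg]
    exact div_le_one_of_le₀ hD (by linarith)
  · have : (0 : ℝ) ≤ s.card - 1 := by linarith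
    positivity
  all_goals rfl

theorem condWeight_nonneg (h3 : 3 ≤ D) (h2 : 2 ≤ s.card) (hD : s.card ≤ D) (w : α) (b : Prop)
    (A : Finset α) : 0 ≤ condWeight D s w b A := by
  unfold condWeight
  split_ifs
  · exact div_nonneg (pairWeight_nonneg h2 hD A) (edgeWeight_pos h3 b).le
  · rfl

theorem pairWeight_of_not_subset {A : Finset α} (h : ¬ A ⊆ s) : pairWeight D s A = 0 :=
  if_neg h

/-- There are `n * (n - 1) / 2` pairs, `n = s.card`, each of weight `2 / (D * (n - 1))`, for a total
of `n / D`; the empty set carries the rest. -/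
theorem sum_pairWeight (h2 : 2 ≤ s.card) (hD : s.card ≤ D) :
    ∑ A ∈ s.powerset, pairWeight D s A = 1 := by
  have h2' : (2 : ℝ) ≤ s.card := by exact_mod_cast h2
  have hD' : (s.card : ℝ) ≤ D := by exact_mod_cast hD
  let f : ℕ → ℝ := fun m => (if m = 0 then 1 - (s.card : ℝ) / D else 0) +
    if m = 2 then 2 / (D * ((s.card : ℝ) - 1)) else 0
  have h : ∑ A ∈ s.powerset, pairWeight D s A = ∑ A ∈ s.powerset, f A.card := by
    refine Finset.sum_congr rfl fun A hA => ?_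
    rw [pairWeight, if_pos (Finset.mem_powerset.1 hA)]
    by_cases h0 : A.card = 0
    · simp [f, h0]
    · simp [f, h0]
  have h3 : (D : ℝ) ≠ 0 := by linarith
  have h4 : (s.card : ℝ) - 1 ≠ 0 := by linarith
  rw [h, Finset.sum_powerset_apply_card]
  simp only [f, smul_add, Finset.sum_add_distrib, smul_ite, smul_zero, Finset.sum_ite_eq',
    Finset.mem_range]
  rw [if_pos (by omega), if_pos (by omega), nsmul_eq_mul, nsmul_eq_mul, Nat.cast_choose_two]
  field_simp
  simp

-- Exactly `s.card - 1` pairs contain `w`. That the answer is free of `s.card` is what lets vertices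
-- of different degrees agree on a common edge.
open Classical in
theorem sum_pairWeight_mem (h2 : 2 ≤ s.card) (hD : s.card ≤ D) {w : α} (hw : w ∈ s) :
    ∑ A ∈ s.powerset, (if w ∈ A then pairWeight D s A else 0) = 2 / D := by
  have h2' : (2 : ℝ) ≤ s.card := by exact_mod_cast h2
  have hD' : (s.card : ℝ) ≤ D := by exact_mod_cast hD
  have hw' : w ∉ s.erase w := Finset.notMem_erase w s
  have hc : (s.erase w).card = s.card - 1 := Finset.card_erase_of_mem hw
  have hsum := Finset.sum_powerset_insert hw' (fun A => if w ∈ A then pairWeight D s A else 0)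
  rw [Finset.insert_erase hw] at hsum
  rw [hsum, Finset.sum_eq_zero, zero_add]
  · let f : ℕ → ℝ := fun m => if m = 1 then 2 / (D * ((s.card : ℝ) - 1)) else 0
    have h : ∀ A ∈ (s.erase w).powerset,
        (if w ∈ insert w A then pairWeight D s (insert w A) else 0) = f A.card := by
      intro A hA
      have hA := Finset.mem_powerset.1 hA
      have hA' : insert w A ⊆ s :=
        Finset.insert_subset hw (hA.trans (Finset.erase_subset w s))
      have hwA : w ∉ A := fun h => hw' (hA h)
      rw [if_pos (Finset.mem_insert_self w A), pairWeight, if_pos hA',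
        Finset.card_insert_of_notMem hwA, if_neg (Nat.succ_ne_zero _)]
      simp [f]
    have h3 : (D : ℝ) ≠ 0 := by linarith
    have h4 : (s.card : ℝ) - 1 ≠ 0 := by linarith
    rw [Finset.sum_congr rfl h, Finset.sum_powerset_apply_card]
    simp only [f, smul_ite, smul_zero, Finset.sum_ite_eq', Finset.mem_range]
    rw [if_pos (by omega), nsmul_eq_mul, Nat.choose_one_right, hc, Nat.cast_sub (by omega)]
    field_simp
    simp
  · intro A hA
    exact if_neg fun h => hw' (Finset.mem_powerset.1 hA h)

theorem sum_condWeight (h3 : 3 ≤ D) (h2 : 2 ≤ s.card) (hD : s.card ≤ D) {w : α} (hw : w ∈ s)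
    (b : Prop) : ∑ A ∈ s.powerset, condWeight D s w b A = 1 := by
  classical
  have h : ∀ A, condWeight D s w b A =
      (if (w ∈ A ↔ b) then pairWeight D s A else 0) / edgeWeight D b := fun A => by
    unfold condWeight
    split_ifs
    · rfl
    · simp
  rw [Finset.sum_congr rfl fun A _ => h A, ← Finset.sum_div,
    div_eq_one_iff_eq (edgeWeight_pos h3 b).ne']
  have hm := sum_pairWeight_mem h2 hD hw
  by_cases hb : b
  · simp only [hb, iff_true, edgeWeight, if_true]
    exact hm
  · simp only [hb, iff_false, edgeWeight, if_false]
    rw [← hm, ← sum_pairWeight h2 hD, ← Finset.sum_sub_distrib]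
    refine Finset.sum_congr rfl fun A _ => ?_
    split_ifs <;> simp_all

theorem pairWeight_empty : pairWeight D s ∅ = 1 - s.card / D := by simp [pairWeight]

/-- Detailed balance across an edge: when the endpoints agree, both sides are the product of the two
pair weights divided by the same edge weight; otherwise both vanish. -/
theorem pairWeight_mul_condWeight {s' A B : Finset α} {v w : α} :
    pairWeight D s A * condWeight D s' v (w ∈ A) B =
      pairWeight D s' B * condWeight D s w (v ∈ B) A := by
  unfold condWeight
  by_cases h : v ∈ B ↔ w ∈ A
  · rw [if_pos h, if_pos h.symm, propext h]
    ring
  · rw [if_neg h, if_neg (fun h' => h h'.symm), mul_zero, mul_zero]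

open Classical in
/-- The law on finite sets with weights `f`, supported on subsets of `s`. -/
noncomputable def setLaw (s : Finset α) (f : Finset α → ℝ) : PMF (Finset α) :=
  if h : (∀ A, 0 ≤ f A) ∧ (∀ A, ¬ A ⊆ s → f A = 0) ∧ ∑ A ∈ s.powerset, f A = 1 then
    .ofFinset (fun A => ENNReal.ofReal (f A)) s.powerset
      (by rw [← ENNReal.ofReal_sum_of_nonneg fun A _ => h.1 A, h.2.2, ENNReal.ofReal_one])
      (fun A hA => by rw [h.2.1 A (by simpa using hA), ENNReal.ofReal_zero])
  -- A default that makes the law total. It can occur for a conditioning vertex outside `s`, but the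
  -- exploration of a good graph never consults such a seed.
  else .pure ∅

theorem setLaw_pairWeight (h2 : 2 ≤ s.card) (hD : s.card ≤ D) (A : Finset α) :
    setLaw s (pairWeight D s) A = ENNReal.ofReal (pairWeight D s A) := by
  rw [setLaw, dif_pos ⟨pairWeight_nonneg h2 hD, fun _ => pairWeight_of_not_subset,
    sum_pairWeight h2 hD⟩]
  rfl

theorem setLaw_condWeight (h3 : 3 ≤ D) (h2 : 2 ≤ s.card) (hD : s.card ≤ D) {w : α} (hw : w ∈ s)
    (b : Prop) (A : Finset α) :
    setLaw s (condWeight D s w b) A = ENNReal.ofReal (condWeight D s w b A) := by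
  rw [setLaw, dif_pos ⟨condWeight_nonneg h3 h2 hD w b,
    fun A hA => by simp [condWeight, pairWeight_of_not_subset hA], sum_condWeight h3 h2 hD hw b⟩]
  rfl

end PairLaw

instance {α : Type*} [Countable α] : MeasurableSingletonClass (Finset α) := by
  refine ⟨fun A => ?_⟩
  have h : {A} = ⋂ a : α, {s : Finset α | a ∈ s ↔ a ∈ A} := by
    ext s
    simp [Finset.ext_iff]
  rw [h]
  refine .iInter fun a => ?_
  exact measurableSet_setOfPred.2 ((measurable_finset_mem a).iff measurable_const)

namespace Network

variable {M : Type} [Zero M]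

/-! ### Parents in a tree -/

open Classical in
/-- A neighbour of `v` which is closer to `o`. -/
noncomputable def parent (N : Network M) (o v : N.V) : N.V :=
  if h : v = o then o else (N.exists_adj_dist_succ h).choose

section parent

variable (N : Network M) {o v w : N.V}

theorem adj_parent (h : v ≠ o) : N.graph.Adj (N.parent o v) v := by
  rw [parent, dif_neg h]
  exact (N.exists_adj_dist_succ h).choose_spec.1

theorem dist_parent (h : v ≠ o) :
    N.graph.dist o (N.parent o v) + 1 = N.graph.dist o v := by
  rw [parent, dif_neg h]
  exact (N.exists_adj_dist_succ h).choose_spec.2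

variable {N}

/-- Extending geodesics from `o` to `w` and to `w'` by a last step to `v` gives two paths from `o`
to `v`, which coincide in a tree. -/
theorem eq_of_adj_of_dist_succ (hT : N.graph.IsTree) {w w' : N.V} (h : N.graph.Adj w v)
    (hd : N.graph.dist o w + 1 = N.graph.dist o v) (h' : N.graph.Adj w' v)
    (hd' : N.graph.dist o w' + 1 = N.graph.dist o v) : w = w' := by
  obtain ⟨p, hp⟩ := N.connected.exists_walk_length_eq_dist o w
  obtain ⟨p', hp'⟩ := N.connected.exists_walk_length_eq_dist o w'
  have h1 : (p.concat h).IsPath := SimpleGraph.Walk.isPath_of_length_eq_dist _ (by simp; omega)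
  have h2 : (p'.concat h').IsPath := SimpleGraph.Walk.isPath_of_length_eq_dist _ (by simp; omega)
  have := congrArg Subtype.val ((hT.isAcyclic.subsingleton_path o v).elim ⟨_, h1⟩ ⟨_, h2⟩)
  exact (SimpleGraph.Walk.concat_inj this).1

theorem eq_parent (hT : N.graph.IsTree) (h : N.graph.Adj w v)
    (hd : N.graph.dist o w + 1 = N.graph.dist o v) : w = N.parent o v := by
  have hv : v ≠ o := by
    rintro rfl
    simp at hd
  exact eq_of_adj_of_dist_succ hT h hd (N.adj_parent hv) (N.dist_parent hv)

theorem parent_eq_root (hT : N.graph.IsTree) (h : N.graph.Adj o v) : N.parent o v = o :=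
  (eq_parent hT h (by rw [SimpleGraph.dist_self, SimpleGraph.dist_eq_one_iff_adj.2 h])).symm

/-- Moving the root across an edge reverses only that edge. -/
theorem parent_eq_parent (hT : N.graph.IsTree) {o' : N.V} (h : N.graph.Adj o o') (hv : v ≠ o)
    (hv' : v ≠ o') : N.parent o v = N.parent o' v := by
  have h1 := N.adj_parent hv
  have h2 := N.dist_parent hv
  refine eq_parent hT h1 ?_
  set w := N.parent o v
  have ho : N.graph.dist o o' = 1 := SimpleGraph.dist_eq_one_iff_adj.2 h
  have ho' : N.graph.dist o' o = 1 := SimpleGraph.dist_eq_one_iff_adj.2 h.symm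
  have t1 := N.connected.dist_triangle (u := o) (v := o') (w := v)
  have t2 := N.connected.dist_triangle (u := o') (v := o) (w := w)
  have t3 := N.connected.dist_triangle (u := o) (v := o') (w := w)
  have t4 := hT.dist_ne_of_adj o' h1
  rcases hT.dist_eq_dist_add_one_of_adj o' h1 with h3 | h3
  -- Suppose that, seen from `o'`, the vertex `v` is closer than `w`. If `w = o`, this forces `v =
  -- o'`. Otherwise `v` and the parent of `w` from `o` are both neighbours of `w` closer to `o'`,
  -- hence equal, although their distances from `o` differ by two.
  · exfalso
    by_cases hw : w = o
    · rw [hw, ho'] at h3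
      exact hv' ((N.connected.dist_eq_zero_iff).1 (by omega : N.graph.dist o' v = 0)).symm
    · have h4 := N.adj_parent hw
      have h5 := N.dist_parent hw
      have t5 := N.connected.dist_triangle (u := o') (v := o) (w := N.parent o w)
      have t6 := N.connected.dist_triangle (u := o) (v := o') (w := N.parent o w)
      have h6 : N.graph.dist o' (N.parent o w) + 1 = N.graph.dist o' w := by
        rcases hT.dist_eq_dist_add_one_of_adj o' h4 with h6 | h6 <;> omega
      have := eq_of_adj_of_dist_succ hT h4 h6 h1.symm (by omega)
      rw [this] at h5
      omega
  · omega

end parent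

end Network

namespace Network

variable {M : Type} [Zero M] (N : Network M) (D : ℕ)

/-- The finite set of neighbours of a vertex. -/
noncomputable def nbr (v : N.V) : Finset N.V := (N.locallyFinite v).toFinset

variable {N} in
theorem mem_nbr {v w : N.V} : w ∈ N.nbr v ↔ N.graph.Adj v w := by
  simp [nbr]

theorem card_nbr (v : N.V) : (N.nbr v).card = N.degree v :=
  (Set.ncard_eq_toFinset_card _ (N.locallyFinite v)).symm

/-- The graph is a tree with degrees in `{2, …, D}`, where `3 ≤ D`. -/
structure IsGood : Prop where
  isTree : N.graph.IsTree
  degree : ∀ v, 2 ≤ N.degree v ∧ N.degree v ≤ D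
  three_le : 3 ≤ D

/-! ### The random set of links at each vertex -/

/-- The laws of the independent choices made at the vertices. The vertex `v` makes one choice for
the case that it is the root, and one for each possible parent `w`, and each possible answer to the
question whether the edge between `w` and `v` is a link. -/
noncomputable def seedLaw : N.V × Option (N.V × Prop) → PMF (Finset N.V)
  | (v, none) => setLaw (N.nbr v) (pairWeight D (N.nbr v))
  | (v, some (w, b)) => setLaw (N.nbr v) (condWeight D (N.nbr v) w b)

/-- All the choices, independently. -/
noncomputable def seedMeasure : Measure (N.V × Option (N.V × Prop) → Finset N.V) :=
  Measure.infinitePi fun i => (N.seedLaw D i).toMeasure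

instance : IsProbabilityMeasure (N.seedMeasure D) := by
  unfold seedMeasure
  infer_instance

open Classical in
/-- The set of links of `v`, found by exploring the graph from the root `o`. -/
noncomputable def links (o : N.V) (ω : N.V × Option (N.V × Prop) → Finset N.V) (v : N.V) :
    Finset N.V :=
  if _h : v = o then ω (o, none)
  else ω (v, some (N.parent o v, v ∈ links o ω (N.parent o v)))
termination_by N.graph.dist o v
decreasing_by
  have := N.dist_parent _h
  omega

theorem links_root (o : N.V) (ω : N.V × Option (N.V × Prop) → Finset N.V) :
    N.links o ω o = ω (o, none) := by
  rw [links, dif_pos rfl]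

theorem links_of_ne {o v : N.V} (h : v ≠ o) (ω : N.V × Option (N.V × Prop) → Finset N.V) :
    N.links o ω v = ω (v, some (N.parent o v, v ∈ N.links o ω (N.parent o v))) := by
  rw [links, dif_neg h]

@[elab_as_elim]
theorem dist_induction (o : N.V) {p : N.V → Prop} (root : p o)
    (step : ∀ v, v ≠ o → p (N.parent o v) → p v) (v : N.V) : p v := by
  induction h : N.graph.dist o v generalizing v with
  | zero => rwa [← (N.connected.dist_eq_zero_iff).1 h]
  | succ n ih =>
    by_cases hv : v = o
    · rwa [hv]
    · have := N.dist_parent hv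
      exact step v hv (ih _ (by omega))

theorem measurable_links (o v : N.V) : Measurable fun ω => N.links o ω v := by
  classical
  induction v using N.dist_induction o with
  | root =>
    simp_rw [links_root]
    exact measurable_pi_apply _
  | step v hv ih =>
    have h : (fun ω => N.links o ω v) = fun ω => if v ∈ N.links o ω (N.parent o v) then
        ω (v, some (N.parent o v, True)) else ω (v, some (N.parent o v, False)) := by
      funext ω
      rw [links_of_ne N hv]
      split_ifs with h <;> simp [h]
    rw [h]
    refine Measurable.ite ?_ (measurable_pi_apply _) (measurable_pi_apply _)
    exact measurableSet_setOfPred.2 ((measurable_finset_mem v).comp ih)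

/-- The law of the sets of links, explored from the root `o`. -/
noncomputable def linkLaw (o : N.V) : Measure (N.V → Finset N.V) :=
  (N.seedMeasure D).map fun ω v => N.links o ω v

instance (o : N.V) : IsProbabilityMeasure (N.linkLaw D o) :=
  Measure.isProbabilityMeasure_map (measurable_pi_lambda _ (N.measurable_links o)).aemeasurable

open Classical in
/-- The choice that determines the set of links of `v`, if the sets of links are `a`. -/
noncomputable def seedIndex (o : N.V) (a : N.V → Finset N.V) (v : N.V) :
    N.V × Option (N.V × Prop) :=
  if v = o then (o, none) else (v, some (N.parent o v, v ∈ a (N.parent o v)))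

theorem seedIndex_fst (o : N.V) (a : N.V → Finset N.V) (v : N.V) :
    (N.seedIndex o a v).1 = v := by
  unfold seedIndex
  split_ifs with h
  · exact h.symm
  · rfl

/-- Once the target configuration `a` is fixed, the seeds read during the exploration are known in
advance. Closure of `S` under parents ensures that `a` is prescribed wherever the exploration looks.
-/
theorem forall_links_eq_iff {o : N.V} {S : Finset N.V} (hS : ∀ v ∈ S, v ≠ o → N.parent o v ∈ S)
    (a : N.V → Finset N.V) (ω : N.V × Option (N.V × Prop) → Finset N.V) :
    (∀ v ∈ S, N.links o ω v = a v) ↔ ∀ v ∈ S, ω (N.seedIndex o a v) = a v := by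
  constructor
  · intro h v hv
    rw [← h v hv]
    by_cases hvo : v = o
    · rw [seedIndex, if_pos hvo, hvo, links_root]
    · rw [seedIndex, if_neg hvo, links_of_ne N hvo, h _ (hS v hv hvo)]
  · intro h v hv
    induction v using N.dist_induction o with
    | root => rw [links_root, ← h o hv, seedIndex, if_pos rfl]
    | step v hvo ih => rw [links_of_ne N hvo, ih (hS v hv hvo), ← h v hv, seedIndex, if_neg hvo]

theorem measurableSet_forall_eq (S : Finset N.V) (a : N.V → Finset N.V) :
    MeasurableSet {C : N.V → Finset N.V | ∀ v ∈ S, C v = a v} := by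
  have : {C : N.V → Finset N.V | ∀ v ∈ S, C v = a v} = Set.pi S fun v => {a v} := by
    ext C
    simp
  rw [this]
  exact .pi S.countable_toSet fun _ _ => measurableSet_singleton _

/-- Different vertices read different seeds, so the event is a box in the product measure. -/
theorem linkLaw_forall_eq {o : N.V} {S : Finset N.V}
    (hS : ∀ v ∈ S, v ≠ o → N.parent o v ∈ S) (a : N.V → Finset N.V) :
    N.linkLaw D o {C | ∀ v ∈ S, C v = a v} =
      ∏ v ∈ S, N.seedLaw D (N.seedIndex o a v) (a v) := by
  classical
  rw [linkLaw, Measure.map_apply (measurable_pi_lambda _ (N.measurable_links o))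
    (N.measurableSet_forall_eq S a)]
  have hinj : Function.Injective (N.seedIndex o a) := fun v w h => by
    rw [← N.seedIndex_fst o a v, h, N.seedIndex_fst]
  have : (fun ω v => N.links o ω v) ⁻¹' {C | ∀ v ∈ S, C v = a v} =
      Set.pi (S.map ⟨_, hinj⟩) fun i => {a i.1} := by
    ext ω
    simp only [Set.mem_preimage, Set.mem_ofPred_eq, Set.mem_pi, Finset.mem_coe, Finset.mem_map,
      Function.Embedding.coeFn_mk, Set.mem_singleton_iff, forall_exists_index, and_imp,
      forall_apply_eq_imp_iff₂, seedIndex_fst]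
    exact N.forall_links_eq_iff hS a ω
  rw [this, seedMeasure, Measure.infinitePi_pi _ fun _ _ => measurableSet_singleton _,
    Finset.prod_map]
  refine Finset.prod_congr rfl fun v _ => ?_
  simp only [Function.Embedding.coeFn_mk, seedIndex_fst]
  exact PMF.toMeasure_apply_singleton _ _ (measurableSet_singleton _)

/-! ### Root independence and marginals of the law of the links -/

variable {N D}

theorem IsGood.seedLaw_none (hN : N.IsGood D) (v : N.V) (A : Finset N.V) :
    N.seedLaw D (v, none) A = ENNReal.ofReal (pairWeight D (N.nbr v) A) :=
  setLaw_pairWeight (by rw [card_nbr]; exact (hN.degree v).1)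
    (by rw [card_nbr]; exact (hN.degree v).2) A

theorem IsGood.seedLaw_some (hN : N.IsGood D) {v w : N.V} (h : N.graph.Adj v w) (b : Prop)
    (A : Finset N.V) :
    N.seedLaw D (v, some (w, b)) A = ENNReal.ofReal (condWeight D (N.nbr v) w b A) :=
  setLaw_condWeight hN.three_le (by rw [card_nbr]; exact (hN.degree v).1)
    (by rw [card_nbr]; exact (hN.degree v).2) (mem_nbr.2 h) b A

theorem IsGood.pairWeight_nonneg (hN : N.IsGood D) (v : N.V) (A : Finset N.V) :
    0 ≤ pairWeight D (N.nbr v) A :=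
  _root_.pairWeight_nonneg (by rw [card_nbr]; exact (hN.degree v).1)
    (by rw [card_nbr]; exact (hN.degree v).2) A

open Classical in
/-- The weight of the vertex `v` in the probability that the sets of links are `a`. -/
noncomputable def localWeight (N : Network M) (D : ℕ) (o : N.V) (a : N.V → Finset N.V) (v : N.V) :
    ℝ :=
  if v = o then pairWeight D (N.nbr v) (a v)
  else condWeight D (N.nbr v) (N.parent o v) (v ∈ a (N.parent o v)) (a v)

theorem IsGood.seedLaw_seedIndex (hN : N.IsGood D) (o : N.V) (a : N.V → Finset N.V) (v : N.V) :
    N.seedLaw D (N.seedIndex o a v) (a v) = ENNReal.ofReal (N.localWeight D o a v) := by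
  unfold seedIndex localWeight
  split_ifs with h
  · rw [h, hN.seedLaw_none]
  · rw [hN.seedLaw_some (N.adj_parent h).symm]

theorem IsGood.linkLaw_forall_eq (hN : N.IsGood D) {o : N.V} {S : Finset N.V}
    (hS : ∀ v ∈ S, v ≠ o → N.parent o v ∈ S) (a : N.V → Finset N.V) :
    N.linkLaw D o {C | ∀ v ∈ S, C v = a v} =
      ∏ v ∈ S, ENNReal.ofReal (N.localWeight D o a v) := by
  rw [N.linkLaw_forall_eq D hS]
  exact Finset.prod_congr rfl fun v _ => hN.seedLaw_seedIndex o a v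

/-- The vertices at distance at most `t` from `o`. -/
noncomputable def ballFinset (N : Network M) (o : N.V) (t : ℕ) : Finset N.V :=
  (N.ball_finite o t).toFinset

theorem mem_ballFinset {o v : N.V} {t : ℕ} : v ∈ N.ballFinset o t ↔ v ∈ N.ball o t := by
  simp [ballFinset]

theorem parent_mem_ballFinset {o v : N.V} {t : ℕ} (hv : v ∈ N.ballFinset o t) (h : v ≠ o) :
    N.parent o v ∈ N.ballFinset o t := by
  have := N.dist_parent h
  rw [mem_ballFinset, mem_ball] at hv ⊢
  omega

/-- Every finite set of vertices lies in a ball, so the balls determine all finite-dimensional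
marginals. Only radii `t ≥ 1` are asked for, so that a ball around `o` also contains any neighbour
chosen as the other root. -/
theorem measure_ext_of_ball {μ ν : Measure (N.V → Finset N.V)} [IsProbabilityMeasure μ]
    [IsProbabilityMeasure ν] (o : N.V)
    (h : ∀ t (a : N.V → Finset N.V), 1 ≤ t → μ {C | ∀ v ∈ N.ballFinset o t, C v = a v} =
      ν {C | ∀ v ∈ N.ballFinset o t, C v = a v}) : μ = ν := by
  classical
  have key : ∀ t, 1 ≤ t → μ.map (N.ballFinset o t).restrict =
      ν.map (N.ballFinset o t).restrict := by
    intro t ht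
    refine Measure.ext_of_singleton fun b => ?_
    have hm : Measurable ((N.ballFinset o t).restrict (π := fun _ => Finset N.V)) :=
      Finset.measurable_restrict _
    rw [Measure.map_apply hm (measurableSet_singleton _),
      Measure.map_apply hm (measurableSet_singleton _)]
    have : (N.ballFinset o t).restrict (π := fun _ => Finset N.V) ⁻¹' {b} = {C : N.V → Finset N.V | ∀ v ∈ N.ballFinset o t,
        C v = if hv : v ∈ N.ballFinset o t then b ⟨v, hv⟩ else ∅} := by
      ext C
      simp only [Set.mem_preimage, Set.mem_singleton_iff, funext_iff, Finset.restrict_def,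
        Subtype.forall, Set.mem_ofPred_eq]
      exact forall₂_congr fun v hv => by rw [dif_pos hv]
    rw [this]
    exact h t _ ht
  refine IsProjectiveLimit.unique (P := fun I => ν.map I.restrict) (fun I => ?_) fun I => rfl
  obtain ⟨t, ht, hI⟩ : ∃ t, 1 ≤ t ∧ I ⊆ N.ballFinset o t := by
    refine ⟨I.sup (N.graph.dist o) + 1, by omega, fun v hv => mem_ballFinset.2 (N.mem_ball.2 ?_)⟩
    have := Finset.le_sup (f := N.graph.dist o) hv
    omega
  have h1 : (I.restrict : (N.V → Finset N.V) → _) =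
      Finset.restrict₂ hI ∘ (N.ballFinset o t).restrict := rfl
  rw [h1, ← Measure.map_map (by fun_prop) (by fun_prop), key t ht,
    Measure.map_map (by fun_prop) (by fun_prop), ← h1]

/-- The ball is closed under parents for both roots, and all factors other than those of `o` and
`o'` are identical. The product of these two is symmetric by detailed balance. -/
theorem IsGood.linkLaw_eq_of_adj (hN : N.IsGood D) {o o' : N.V} (h : N.graph.Adj o o') :
    N.linkLaw D o = N.linkLaw D o' := by
  classical
  refine measure_ext_of_ball o fun t a ht => ?_
  set S := N.ballFinset o t
  have ho : o ∈ S := mem_ballFinset.2 (N.self_mem_ball o t)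
  have ho' : o' ∈ S := mem_ballFinset.2 (by rwa [mem_ball, SimpleGraph.dist_eq_one_iff_adj.2 h])
  have hS : ∀ v ∈ S, v ≠ o → N.parent o v ∈ S := fun v => parent_mem_ballFinset
  have hS' : ∀ v ∈ S, v ≠ o' → N.parent o' v ∈ S := fun v hv hvo' => by
    by_cases hvo : v = o
    · rwa [hvo, parent_eq_root hN.isTree h.symm]
    · rw [← parent_eq_parent hN.isTree h hvo hvo']
      exact hS v hv hvo
  rw [hN.linkLaw_forall_eq hS, hN.linkLaw_forall_eq hS']
  have hne : o' ≠ o := h.ne'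
  have ho1 : o' ∈ S.erase o := Finset.mem_erase.2 ⟨hne, ho'⟩
  rw [← Finset.mul_prod_erase S _ ho, ← Finset.mul_prod_erase _ _ ho1,
    ← Finset.mul_prod_erase S _ ho, ← Finset.mul_prod_erase _ _ ho1, ← mul_assoc, ← mul_assoc]
  congr 1
  · simp only [localWeight, if_pos, if_neg hne, if_neg hne.symm, parent_eq_root hN.isTree h,
      parent_eq_root hN.isTree h.symm]
    rw [mul_comm (ENNReal.ofReal (condWeight _ _ _ _ _)),
      ← ENNReal.ofReal_mul (hN.pairWeight_nonneg _ _),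
      ← ENNReal.ofReal_mul (hN.pairWeight_nonneg _ _), pairWeight_mul_condWeight]
  · refine Finset.prod_congr rfl fun v hv => ?_
    obtain ⟨h1, h2, -⟩ : v ≠ o' ∧ v ≠ o ∧ v ∈ S := by simpa using hv
    simp only [localWeight, if_neg h1, if_neg h2, parent_eq_parent hN.isTree h h2 h1]

/-- The law of the links does not depend on the root of the exploration. -/
theorem IsGood.linkLaw_eq (hN : N.IsGood D) (o o' : N.V) : N.linkLaw D o = N.linkLaw D o' := by
  obtain ⟨p⟩ := N.connected.preconnected o o'
  induction p with
  | nil => rfl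
  | cons h _ ih => exact (hN.linkLaw_eq_of_adj h).trans ih

/-- With the exploration restarted at `v`, the set `{v}` is closed under parents and the marginal is
a single factor. -/
theorem IsGood.linkLaw_apply_eq (hN : N.IsGood D) (o v : N.V) (A : Finset N.V) :
    N.linkLaw D o {C | C v = A} = ENNReal.ofReal (pairWeight D (N.nbr v) A) := by
  have := hN.linkLaw_forall_eq (o := v) (S := {v}) (by simp) fun _ => A
  rw [hN.linkLaw_eq o v]
  simpa [localWeight] using this

theorem IsGood.linkLaw_apply_eq_and (hN : N.IsGood D) (o : N.V) {v w : N.V}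
    (h : N.graph.Adj v w) (A B : Finset N.V) :
    N.linkLaw D o {C | C v = A ∧ C w = B} = ENNReal.ofReal (pairWeight D (N.nbr v) A) *
      ENNReal.ofReal (condWeight D (N.nbr w) v (w ∈ A) B) := by
  classical
  have := hN.linkLaw_forall_eq (o := v) (S := {v, w})
    (by simp [parent_eq_root hN.isTree h]) fun u => if u = v then A else B
  rw [hN.linkLaw_eq o v]
  rw [Finset.prod_pair h.ne] at this
  simpa [localWeight, h.ne', parent_eq_root hN.isTree h] using this

theorem IsGood.ae_pairWeight_ne_zero (hN : N.IsGood D) (o : N.V) :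
    ∀ᵐ C ∂N.linkLaw D o, ∀ v, pairWeight D (N.nbr v) (C v) ≠ 0 := by
  refine ae_all_iff.2 fun v => ?_
  have : {C : N.V → Finset N.V | ¬pairWeight D (N.nbr v) (C v) ≠ 0} ⊆
      ⋃ A ∈ {A | pairWeight D (N.nbr v) A = 0}, {C | C v = A} := fun C hC => by simpa using hC
  refine measure_mono_null this ((measure_biUnion_null_iff (Set.to_countable _)).2 fun A hA => ?_)
  rw [hN.linkLaw_apply_eq, show pairWeight D (N.nbr v) A = 0 from hA, ENNReal.ofReal_zero]

/-- The conditional weight vanishes on pairs of choices that disagree about the edge, and there are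
only countably many pairs. -/
theorem IsGood.ae_mem_iff (hN : N.IsGood D) (o : N.V) :
    ∀ᵐ C ∂N.linkLaw D o, ∀ v w, N.graph.Adj v w → (v ∈ C w ↔ w ∈ C v) := by
  refine ae_all_iff.2 fun v => ae_all_iff.2 fun w => ?_
  by_cases h : N.graph.Adj v w
  · have : {C : N.V → Finset N.V | ¬(N.graph.Adj v w → (v ∈ C w ↔ w ∈ C v))} ⊆
        ⋃ p ∈ {p : Finset N.V × Finset N.V | ¬(v ∈ p.2 ↔ w ∈ p.1)},
          {C | C v = p.1 ∧ C w = p.2} := fun C hC => by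
      simp only [Set.mem_ofPred_eq, h, true_imp_iff] at hC
      simp only [Set.mem_iUnion]
      exact ⟨(C v, C w), hC, rfl, rfl⟩
    refine measure_mono_null this
      ((measure_biUnion_null_iff (Set.to_countable _)).2 fun p hp => ?_)
    rw [hN.linkLaw_apply_eq_and o h, condWeight, if_neg hp, ENNReal.ofReal_zero, mul_zero]
  · simp [h]

theorem IsGood.linkLaw_nonempty (hN : N.IsGood D) (o v : N.V) :
    N.linkLaw D o {C | (C v).Nonempty} = ENNReal.ofReal (N.degree v / D) := by
  have h : {C : N.V → Finset N.V | (C v).Nonempty} = {C | C v = ∅}ᶜ := by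
    ext C
    simp [Finset.nonempty_iff_ne_empty]
  have hm : MeasurableSet {C : N.V → Finset N.V | C v = ∅} :=
    measurable_pi_apply v (measurableSet_singleton ∅)
  have h0 := hN.pairWeight_nonneg v ∅
  rw [h, prob_compl_eq_one_sub hm, hN.linkLaw_apply_eq, ← ENNReal.ofReal_one,
    ← ENNReal.ofReal_sub _ h0, pairWeight_empty, card_nbr, sub_sub_cancel]

end Network

/-! ### Locality of the law of the links -/

theorem pairWeight_map {α β : Type*} (f : α ↪ β) (D : ℕ) (s A : Finset α) :
    pairWeight D (s.map f) (A.map f) = pairWeight D s A := by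
  by_cases h : A ⊆ s
  · rw [pairWeight, if_pos (Finset.map_subset_map.2 h), pairWeight, if_pos h, Finset.card_map,
      Finset.card_map]
  · rw [pairWeight_of_not_subset h,
      pairWeight_of_not_subset fun h' => h (Finset.map_subset_map.1 h')]

theorem condWeight_map {α β : Type*} (f : α ↪ β) (D : ℕ) (s A : Finset α) (w : α) (b : Prop) :
    condWeight D (s.map f) (f w) b (A.map f) = condWeight D s w b A := by
  have h : (f w ∈ A.map f ↔ b) ↔ (w ∈ A ↔ b) := by rw [Finset.mem_map']
  by_cases h' : w ∈ A ↔ b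
  · rw [condWeight, if_pos (h.2 h'), condWeight, if_pos h', pairWeight_map]
  · rw [condWeight, if_neg (h.not.2 h'), condWeight, if_neg h']

namespace Network

/-- The edge between `u` and `v` is chosen by both of its endpoints. -/
def IsLink (N : Network Unit) (C : N.V → Finset N.V) (u v : N.V) : Prop :=
  N.graph.Adj u v ∧ u ∈ C v ∧ v ∈ C u

open Classical in
/-- The weighted graph in which an edge has weight `1` if both endpoints choose it. -/
noncomputable def withLinks (N : Network Unit) (C : N.V → Finset N.V) : Network ℤ where
  V := N.V
  graph := N.graph
  connected := N.connected
  locallyFinite := N.locallyFinite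
  weight := fun u v => if N.IsLink C u v then 1 else 0
  weight_eq_zero := fun _ _ _ h => if_neg fun h' => h h'.1

theorem IsBallIso.withLinks {N N' : Network Unit} {o : N.V} {o' : N'.V} {t : ℕ}
    {e : N.ball o t ≃ N'.ball o' t} (he : IsBallIso e) {C : N.V → Finset N.V}
    {C' : N'.V → Finset N'.V}
    (h : ∀ u v : N.ball o t, (u : N.V) ∈ C v ↔ (e u : N'.V) ∈ C' (e v)) :
    IsBallIso (N := N.withLinks C) (N' := N'.withLinks C') e := by
  refine ⟨⟨he.induced.1, fun (u v : N.ball o t) => ?_⟩, he.root⟩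
  have hl : N.IsLink C u v = N'.IsLink C' (e u) (e v) :=
    propext (and_congr (he.adj_iff u v) (and_congr (h u v) (h v u)))
  by_cases hc : N'.IsLink C' (e u) (e v)
  · exact (if_pos (hl.mpr hc)).trans (if_pos hc).symm
  · exact (if_neg (hl ▸ hc)).trans (if_neg hc).symm

theorem IsBallIso.parent_eq {N N' : Network Unit} (hT : N'.graph.IsTree) {o : N.V} {o' : N'.V}
    {R : ℕ} {e : N.ball o R ≃ N'.ball o' R} (he : IsBallIso e) {v w : N.ball o R}
    (hv : (v : N.V) ≠ o) (hw : (w : N.V) = N.parent o v) : N'.parent o' (e v) = e w := by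
  refine (eq_parent hT ((he.adj_iff w v).1 (hw ▸ N.adj_parent hv)) ?_).symm
  rw [he.dist_root, he.dist_root, hw]
  exact N.dist_parent hv

open Classical in
/-- The links between the vertices of a ball of radius `R`, chosen in a ball of radius `t`. -/
noncomputable def ballLinks (N : Network Unit) (o : N.V) (t R : ℕ) (C : N.V → Finset N.V)
    (v : N.ball o t) : Finset (N.ball o R) :=
  (C v).subtype (· ∈ N.ball o R)

theorem mem_ballLinks {N : Network Unit} {o : N.V} {t R : ℕ} {C : N.V → Finset N.V}
    {v : N.ball o t} {w : N.ball o R} : w ∈ N.ballLinks o t R C v ↔ (w : N.V) ∈ C v := by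
  simp [ballLinks]

theorem measurable_ballLinks (N : Network Unit) (o : N.V) (t R : ℕ) :
    Measurable (N.ballLinks o t R) := by
  refine measurable_pi_lambda _ fun v => measurable_finset_iff.2 fun w => ?_
  simp_rw [mem_ballLinks]
  exact (measurable_finset_mem _).comp (measurable_pi_apply _)

open Classical in
theorem ballLinks_surjective (N : Network Unit) (o : N.V) (t R : ℕ) :
    Function.Surjective (N.ballLinks o t R) := by
  intro b
  refine ⟨fun v => if h : v ∈ N.ball o t then (b ⟨v, h⟩).map (.subtype _) else ∅, ?_⟩
  funext v
  ext w
  simp [mem_ballLinks]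

theorem subset_nbr_of_pairWeight_ne_zero {N : Network Unit} {D : ℕ} {v : N.V}
    {A : Finset N.V} (h : pairWeight D (N.nbr v) A ≠ 0) : A ⊆ N.nbr v := by
  by_contra h'
  exact h (pairWeight_of_not_subset h')

/-- The probability of a local configuration. -/
theorem IsGood.map_ballLinks_singleton {N : Network Unit} {D : ℕ} (hN : N.IsGood D) (o : N.V)
    {t R : ℕ} (hR : t + 1 ≤ R) (b : N.ball o t → Finset (N.ball o R)) (a : N.V → Finset N.V)
    (ha : ∀ v : N.ball o t, a v = (b v).map (.subtype _)) :
    N.linkLaw D o (N.ballLinks o t R ⁻¹' {b}) =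
      ∏ v ∈ N.ballFinset o t, ENNReal.ofReal (N.localWeight D o a v) := by
  rw [← hN.linkLaw_forall_eq (fun v => parent_mem_ballFinset)]
  -- The two events agree outside the null set where some vertex chooses a non-neighbour: choices
  -- made in the ball of radius `t` then lie in the ball of radius `t + 1 ≤ R`.
  refine measure_congr ?_
  filter_upwards [hN.ae_pairWeight_ne_zero o] with C hC
  refine propext ?_
  have hsub : ∀ v : N.ball o t, ∀ w ∈ C v, w ∈ N.ball o R := fun v w hw =>
    N.ball_mono o hR (N.mem_ball_succ_of_adj v.2
      (mem_nbr.1 (subset_nbr_of_pairWeight_ne_zero (hC v) hw)))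
  constructor
  · intro h v hv
    have hv : v ∈ N.ball o t := mem_ballFinset.1 hv
    have h : N.ballLinks o t R C = b := h
    rw [ha ⟨v, hv⟩, ← h]
    ext w
    simp only [Finset.mem_map, mem_ballLinks, Function.Embedding.subtype_apply, Subtype.exists,
      exists_and_left, exists_prop, exists_eq_right_right]
    exact ⟨fun hw => ⟨hw, hsub ⟨v, hv⟩ w hw⟩, fun hw => hw.1⟩
  · intro h
    change N.ballLinks o t R C = b
    funext v
    ext w
    have h1 : C v = a v := h v (mem_ballFinset.2 v.2)
    rw [mem_ballLinks, h1, ha]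
    simp

/-- Both laws live on a finite set of configurations, where each atom is a product of local weights
over the ball of radius `t`. These weights involve only neighbours and parents, which `e` preserves
because the ball of radius `t + 1` lies in its domain. -/
theorem IsBallIso.map_ballLinks_eq {N N' : Network Unit} {D : ℕ} (hN : N.IsGood D)
    (hN' : N'.IsGood D) {o : N.V} {o' : N'.V} {t R : ℕ} (hR : t + 1 ≤ R)
    {e : N.ball o R ≃ N'.ball o' R} (he : IsBallIso e) {et : N.ball o t ≃ N'.ball o' t}
    (het : ∀ (v : N.ball o t) (w : N.ball o R), (v : N.V) = w → (et v : N'.V) = e w) :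
    (N.linkLaw D o).map (N.ballLinks o t R) =
      (N'.linkLaw D o').map
        (fun C' v => (N'.ballLinks o' t R C' (et v)).map e.symm.toEmbedding) := by
  classical
  have htR : t ≤ R := by omega
  have hm : Measurable fun (C' : N'.V → Finset N'.V) (v : N.ball o t) =>
      (N'.ballLinks o' t R C' (et v)).map e.symm.toEmbedding := by
    refine measurable_pi_lambda _ fun v => measurable_finset_iff.2 fun w => ?_
    simp only [Finset.mem_map_equiv, Equiv.symm_symm]
    exact (measurable_finset_mem _).comp
      ((measurable_pi_apply _).comp (N'.measurable_ballLinks o' t R))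
  refine Measure.ext_of_singleton fun b => ?_
  rw [Measure.map_apply (N.measurable_ballLinks o t R) (measurableSet_singleton _),
    Measure.map_apply hm (measurableSet_singleton _)]
  let b' : N'.ball o' t → Finset (N'.ball o' R) := fun v => (b (et.symm v)).map e.toEmbedding
  have hpre : (fun (C' : N'.V → Finset N'.V) (v : N.ball o t) =>
      (N'.ballLinks o' t R C' (et v)).map e.symm.toEmbedding) ⁻¹' {b} =
        N'.ballLinks o' t R ⁻¹' {b'} := by
    ext C'
    simp only [Set.mem_preimage, Set.mem_singleton_iff, funext_iff, b']
    constructor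
    · intro h v
      rw [← h]
      ext w
      simp
    · intro h v
      rw [h]
      ext w
      simp
  rw [hpre]
  let a : N.V → Finset N.V := fun v =>
    if h : v ∈ N.ball o t then (b ⟨v, h⟩).map (.subtype _) else ∅
  let a' : N'.V → Finset N'.V := fun v =>
    if h : v ∈ N'.ball o' t then (b' ⟨v, h⟩).map (.subtype _) else ∅
  have ha : ∀ v : N.ball o t, a v = (b v).map (.subtype _) := fun v => by simp [a]
  have ha' : ∀ v : N'.ball o' t, a' v = (b' v).map (.subtype _) := fun v => by simp [a']
  rw [hN.map_ballLinks_singleton o hR b a ha, hN'.map_ballLinks_singleton o' hR b' a' ha']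
  let f : N.ball o R ↪ N'.V := e.toEmbedding.trans (.subtype _)
  have haf : ∀ v : N.ball o t, a' (et v) = (b v).map f := fun v => by
    simp [ha', b', f, Finset.map_map]
  have hnbr : ∀ v : N.ball o t, N.nbr v = ((N.nbr v).subtype (· ∈ N.ball o R)).map (.subtype _) :=
    fun v => (Finset.subtype_map_of_mem fun w hw =>
      N.ball_mono o hR (N.mem_ball_succ_of_adj v.2 (mem_nbr.1 hw))).symm
  have hnbr' : ∀ v : N.ball o t,
      N'.nbr (et v) = ((N.nbr v).subtype (· ∈ N.ball o R)).map f := fun v => by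
    have h1 := het v ⟨v, N.ball_mono o htR v.2⟩ rfl
    have hset := he.image_neighborSet ⟨v, N.ball_mono o htR v.2⟩
      ((Nat.add_le_add_right v.2 1).trans hR)
    ext w
    rw [mem_nbr, ← SimpleGraph.mem_neighborSet, h1, ← hset]
    simp [f, mem_nbr]
  refine Finset.prod_bij (fun v hv => (et ⟨v, mem_ballFinset.1 hv⟩ : N'.V))
    (fun v hv => mem_ballFinset.2 (et _).2) (fun v hv w hw h => ?_) (fun v hv => ?_)
    fun v hv => ?_
  · exact congrArg Subtype.val (et.injective (Subtype.ext h))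
  · exact ⟨et.symm ⟨v, mem_ballFinset.1 hv⟩, mem_ballFinset.2 (et.symm _).2, by simp⟩
  · obtain ⟨v, rfl⟩ : ∃ v' : N.ball o t, (v' : N.V) = v := ⟨⟨v, mem_ballFinset.1 hv⟩, rfl⟩
    congr 1
    have h1 := het v ⟨v, N.ball_mono o htR v.2⟩ rfl
    have hroot : (v : N.V) = o ↔ (et v : N'.V) = o' := by
      rw [h1]
      exact e.val_eq_iff he.root ⟨v, N.ball_mono o htR v.2⟩
    change _ = N'.localWeight D o' a' (et v)
    unfold localWeight
    by_cases hvo : (v : N.V) = o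
    · rw [if_pos hvo, if_pos (hroot.1 hvo), hnbr, hnbr', haf, ha, pairWeight_map, pairWeight_map]
    · rw [if_neg hvo, if_neg (hroot.not.1 hvo)]
      have hpt : N.parent o v ∈ N.ball o t :=
        mem_ballFinset.1 (parent_mem_ballFinset (mem_ballFinset.2 v.2) hvo)
      have hp : N'.parent o' (et v) = f ⟨N.parent o v, N.ball_mono o htR hpt⟩ := by
        rw [h1]
        exact he.parent_eq hN'.isTree hvo rfl
      have hp' : N'.parent o' (et v) = et ⟨N.parent o v, hpt⟩ :=
        hp.trans (het ⟨_, hpt⟩ ⟨_, N.ball_mono o htR hpt⟩ rfl).symm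
      have hmem : ((et v : N'.V) ∈ a' (N'.parent o' (et v))) = ((v : N.V) ∈ a (N.parent o v)) := by
        have hv' : (et v : N'.V) = f ⟨v, N.ball_mono o htR v.2⟩ := h1
        rw [hp', haf, hv', Finset.mem_map', ha ⟨_, hpt⟩]
        exact propext (Finset.mem_map' (.subtype (· ∈ N.ball o R))).symm
      rw [hmem, hp, hnbr, hnbr', haf, ha, condWeight_map]
      exact (condWeight_map (.subtype _) D _ _ ⟨N.parent o v, N.ball_mono o htR hpt⟩ _).symm ▸ rfl

end Network

namespace BirootedNetwork

/-- The graph with two roots, weighted by the links. -/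
noncomputable def withLinks (N : BirootedNetwork Unit) (C : N.V → Finset N.V) :
    BirootedNetwork ℤ :=
  ⟨N.toNetwork.withLinks C, N.root, N.root'⟩

/-- The larger radius `R` only serves to locate the second root. If that root is farther than `t`
from the first, neither graph belongs to any cylinder of radius `t`. -/
theorem mk_withLinks_mem_cyl {N N' : BirootedNetwork Unit} {t R : ℕ} (ht : t ≤ R)
    {e : N.toNetwork.ball N.root R ≃ N'.toNetwork.ball N'.root R} (he : Network.IsBallIso e)
    (hr : N.root' ∈ N.toNetwork.ball N.root R) (hr' : (e ⟨N.root', hr⟩ : N'.V) = N'.root')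
    {C : N.V → Finset N.V} {C' : N'.V → Finset N'.V}
    (h : ∀ u v : N.toNetwork.ball N.root R, (v : N.V) ∈ N.toNetwork.ball N.root t →
      ((u : N.V) ∈ C v ↔ (e u : N'.V) ∈ C' (e v))) (N₀ : BirootedNetwork ℤ) :
    GStarStar.mk (N.withLinks C) ∈ GStarStar.cyl t N₀ ↔
      GStarStar.mk (N'.withLinks C') ∈ GStarStar.cyl t N₀ := by
  by_cases hrt : N.root' ∈ N.toNetwork.ball N.root t
  · obtain ⟨et, het, het'⟩ := he.exists_restrict ⟨N.root, N.self_mem_ball N.root R⟩ (t := t)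
      (by simpa using ht)
    revert et
    rw [he.root]
    intro et het het'
    have hb : (N.withLinks C).BallIso t (N'.withLinks C') := by
      refine ballIso_iff.2 ⟨hrt, et, het.withLinks fun u v => ?_, (het' ⟨_, hrt⟩).trans hr'⟩
      rw [het', het']
      exact h ⟨u, N.ball_mono _ ht u.2⟩ ⟨v, N.ball_mono _ ht v.2⟩ v.2
    simp only [GStarStar.mk_mem_cyl]
    exact ⟨fun h => hb.symm.trans h, fun h => hb.trans h⟩
  · have hrt' : N'.root' ∉ N'.toNetwork.ball N'.root t := by
      rwa [Network.mem_ball, ← hr', he.dist_root]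
    simp only [GStarStar.mk_mem_cyl]
    exact ⟨fun h => absurd h.1 hrt, fun h => absurd h.1 hrt'⟩

/-- A cylinder event depends only on the links in a finite ball, so it is the preimage of its image
in a countable discrete space. -/
theorem measurable_mk_withLinks (N : BirootedNetwork Unit) :
    Measurable fun C => GStarStar.mk (N.withLinks C) := by
  refine GStarStar.measurable_of_cyl fun t N₀ => ?_
  let R := max t (N.graph.dist N.root N.root')
  have hmR : Measurable (N.ballLinks N.root R R) := N.measurable_ballLinks N.root R R
  have : (fun C => GStarStar.mk (N.withLinks C)) ⁻¹' GStarStar.cyl t N₀ =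
      N.ballLinks N.root R R ⁻¹' (N.ballLinks N.root R R ''
        ((fun C => GStarStar.mk (N.withLinks C)) ⁻¹' GStarStar.cyl t N₀)) := by
    refine (Set.subset_preimage_image _ _).antisymm ?_
    rintro C ⟨C', hC', hCC'⟩
    refine (mk_withLinks_mem_cyl (e := Equiv.refl (N.toNetwork.ball N.root R)) (le_max_left _ _)
      ⟨⟨fun _ _ => Iff.rfl, fun _ _ => rfl⟩, rfl⟩ (N.mem_ball.2 (le_max_right _ _)) rfl
      (fun u v _ => ?_) N₀).1 hC'
    have := congrFun hCC' v
    have h1 : u ∈ N.ballLinks N.root R R C' v ↔ u ∈ N.ballLinks N.root R R C v := by rw [this]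
    rw [Network.mem_ballLinks, Network.mem_ballLinks] at h1
    exact h1
  rw [this]
  exact hmR (Set.to_countable _).measurableSet

/-- The law of the graph with two roots, weighted by random links. -/
noncomputable def netLaw (D : ℕ) (N : BirootedNetwork Unit) : Measure (GStarStar ℤ) :=
  (N.linkLaw D N.root).map fun C => GStarStar.mk (N.withLinks C)

instance (D : ℕ) (N : BirootedNetwork Unit) : IsProbabilityMeasure (N.netLaw D) :=
  Measure.isProbabilityMeasure_map N.measurable_mk_withLinks.aemeasurable

/-- The variables `X` and `X'` record the links of both graphs in one countable space and have equal
laws there. Surjectivity of `X` makes both cylinder events preimages of the same set `X '' E`. -/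
theorem netLaw_cyl_eq {D : ℕ} {N N' : BirootedNetwork Unit} (hN : N.IsGood D) (hN' : N'.IsGood D)
    {t R : ℕ} (hR : t + 1 ≤ R) (h : N.BallIso R N') (N₀ : BirootedNetwork ℤ) :
    N.netLaw D (GStarStar.cyl t N₀) = N'.netLaw D (GStarStar.cyl t N₀) := by
  have htR : t ≤ R := by omega
  obtain ⟨hr, e, he, hr'⟩ := ballIso_iff.1 h
  obtain ⟨et, het⟩ : ∃ et : N.toNetwork.ball N.root t ≃ N'.toNetwork.ball N'.root t,
      ∀ u : N.toNetwork.ball N.root t, (et u : N'.V) = e ⟨u, N.ball_mono N.root htR u.2⟩ := by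
    obtain ⟨et, -, het'⟩ := he.exists_restrict ⟨N.root, N.self_mem_ball N.root R⟩ (t := t)
      (by simpa using htR)
    revert et
    rw [he.root]
    exact fun et het => ⟨et, het⟩
  have hmap := he.map_ballLinks_eq hN hN' hR (et := et)
    fun v w hvw => by rw [het]; exact congrArg (fun x => (e x : N'.V)) (Subtype.ext hvw)
  have hm := (GStarStar.isOpen_cyl t N₀).measurableSet
  rw [netLaw, netLaw, Measure.map_apply N.measurable_mk_withLinks hm,
    Measure.map_apply N'.measurable_mk_withLinks hm]
  set X := N.ballLinks N.root t R
  let X' : (N'.V → Finset N'.V) → N.toNetwork.ball N.root t → Finset (N.toNetwork.ball N.root R) :=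
    fun C' v => (N'.ballLinks N'.root t R C' (et v)).map e.symm.toEmbedding
  change _ = Measure.map X' _ at hmap
  have hX' : Measurable X' := by
    refine measurable_pi_lambda _ fun v => measurable_finset_iff.2 fun w => ?_
    simp only [X', Finset.mem_map_equiv, Equiv.symm_symm]
    exact (measurable_finset_mem _).comp
      ((measurable_pi_apply _).comp (N'.measurable_ballLinks N'.root t R))
  set E := (fun C => GStarStar.mk (N.withLinks C)) ⁻¹' GStarStar.cyl t N₀
  set E' := (fun C => GStarStar.mk (N'.withLinks C)) ⁻¹' GStarStar.cyl t N₀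
  have key : ∀ C C', X C = X' C' → (C ∈ E ↔ C' ∈ E') := fun C C' hCC' => by
    refine mk_withLinks_mem_cyl htR he hr hr' (fun u v hv => ?_) N₀
    have h1 : u ∈ X C ⟨v, hv⟩ ↔ u ∈ X' C' ⟨v, hv⟩ := by rw [hCC']
    rw [Network.mem_ballLinks, Finset.mem_map_equiv, Equiv.symm_symm, Network.mem_ballLinks,
      het] at h1
    exact h1
  have key' : ∀ C C₁, X C = X C₁ → (C ∈ E ↔ C₁ ∈ E) := fun C C₁ hCC => by
    refine mk_withLinks_mem_cyl htR (e := Equiv.refl (N.toNetwork.ball N.root R))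
      ⟨⟨fun _ _ => Iff.rfl, fun _ _ => rfl⟩, rfl⟩ hr rfl (fun u v hv => ?_) N₀
    have h1 : u ∈ X C ⟨v, hv⟩ ↔ u ∈ X C₁ ⟨v, hv⟩ := by rw [hCC]
    rwa [Network.mem_ballLinks, Network.mem_ballLinks] at h1
  have hsurj : Function.Surjective X := N.ballLinks_surjective N.root t R
  have hE : E = X ⁻¹' (X '' E) := by
    refine (Set.subset_preimage_image _ _).antisymm ?_
    rintro C ⟨C₁, hC₁, h⟩
    exact (key' C₁ C h).1 hC₁
  have hE' : E' = X' ⁻¹' (X '' E) := by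
    ext C'
    constructor
    · intro hC'
      obtain ⟨C, hC⟩ := hsurj (X' C')
      exact ⟨C, (key C C' hC).2 hC', hC⟩
    · rintro ⟨C, hC, h⟩
      exact (key C C' h).1 hC
  rw [hE', ← Measure.map_apply hX' (Set.to_countable _).measurableSet, ← hmap,
    Measure.map_apply (N.measurable_ballLinks N.root t R) (Set.to_countable _).measurableSet, ← hE]

end BirootedNetwork

/-! ### Good graphs and the kernel from graphs to weighted graphs -/

namespace Network

theorem IsIso.isGood {N N' : Network Unit} {e : N.V ≃ N'.V} (h : IsIso e) {D : ℕ}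
    (hN : N.IsGood D) : N'.IsGood D :=
  ⟨h.isTree hN.isTree, fun v => by rw [h.symm.degree_eq v]; exact hN.degree _, hN.three_le⟩

theorem exists_not_isAcyclic_induce_ball (N : Network Unit) (o : N.V) (h : ¬N.graph.IsAcyclic) :
    ∃ R, ∀ R' ≥ R, ¬(N.graph.induce (N.ball o R')).IsAcyclic := by
  classical
  simp only [SimpleGraph.IsAcyclic, not_forall, not_not] at h
  obtain ⟨v, c, hc⟩ := h
  refine ⟨c.support.toFinset.sup (N.graph.dist o), fun R' hR' hac => ?_⟩
  have hs : ∀ x ∈ c.support, x ∈ N.ball o R' := fun x hx =>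
    (Finset.le_sup (f := N.graph.dist o) (List.mem_toFinset.2 hx)).trans hR'
  refine hac (c.induce _ hs) ?_
  rw [← SimpleGraph.Walk.isCycle_map_iff_of_injective
    (f := (SimpleGraph.Embedding.induce (N.ball o R')).toHom) Subtype.val_injective,
    SimpleGraph.Walk.map_induce]
  exact hc

end Network

namespace GStarStar

/-- The graph is a tree with degrees in `{2, …, D}`, where `3 ≤ D`. -/
def IsGood (D : ℕ) : GStarStar Unit → Prop :=
  Quotient.lift (fun N : BirootedNetwork Unit => N.IsGood D)
    (by
      rintro N N' ⟨e, he, -⟩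
      exact propext ⟨he.isGood, he.symm.isGood⟩)

theorem isGood_mk {D : ℕ} {N : BirootedNetwork Unit} : IsGood D (mk N) ↔ N.IsGood D := Iff.rfl

/-- The good graphs form a closed set: a cycle or a vertex of forbidden degree is already visible in
a finite ball. -/
theorem measurableSet_isGood (D : ℕ) : MeasurableSet {x | IsGood D x} := by
  rw [← MeasurableSet.compl_iff]
  refine (isOpen_of_local fun N hN => ?_).measurableSet
  by_contra! h
  refine hN ?_
  have h' : ∀ R, N.graph.dist N.root N.root' ≤ R →
      ∃ N' : BirootedNetwork Unit, N'.BallIso R N ∧ N'.IsGood D := fun R hR => by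
    obtain ⟨N', h1, h2⟩ := h R hR
    exact ⟨N', h1, not_not.1 h2⟩
  refine ⟨⟨N.connected, ?_⟩, fun v => ?_, ?_⟩
  · by_contra hac
    obtain ⟨R, hR⟩ := N.exists_not_isAcyclic_induce_ball N.root hac
    obtain ⟨N', h1, h2⟩ := h' _ (le_max_right R _)
    obtain ⟨-, e, he, -⟩ := BirootedNetwork.ballIso_iff.1 h1
    have i : N'.graph.induce (N'.toNetwork.ball N'.root (max R (N.graph.dist N.root N.root'))) ≃g
        N.graph.induce (N.toNetwork.ball N.root (max R (N.graph.dist N.root N.root'))) :=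
      ⟨e, fun {a b} => (he.adj_iff a b).symm⟩
    exact hR _ (le_max_left _ _) (i.isAcyclic_iff.1 (h2.isTree.isAcyclic.induce _))
  · obtain ⟨N', h1, h2⟩ := h' _ (le_max_right (N.graph.dist N.root v + 1) _)
    obtain ⟨-, e, he, -⟩ := BirootedNetwork.ballIso_iff.1 h1.symm
    have := he.degree_eq ⟨v, N.mem_ball.2 (by omega)⟩ (le_max_left _ _)
    rw [← this]
    exact h2.degree _
  · obtain ⟨N', -, h2⟩ := h' _ le_rfl
    exact h2.three_le

/-- A version of local constancy relative to a measurable set, needed because the kernel is locally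
constant among good graphs but drops to zero elsewhere. -/
theorem measurable_of_local_on {M : Type} [Zero M] {β : Type*} [MeasurableSpace β]
    {G : Set (GStarStar M)} (hG : MeasurableSet G) {g : GStarStar M → β} {c : β}
    (h0 : ∀ x ∉ G, g x = c)
    (h : ∀ N, mk N ∈ G → ∃ t, N.root' ∈ N.toNetwork.ball N.root t ∧
      ∀ N', mk N' ∈ G → N'.BallIso t N → g (mk N') = g (mk N)) : Measurable g := by
  choose! t ht ht' using h
  intro s _
  have hg : g ⁻¹' s = (G ∩ ⋃ N ∈ {N | mk N ∈ G ∧ g (mk N) ∈ s}, cyl (t N) N) ∪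
      (Gᶜ ∩ {_x | c ∈ s}) := by
    ext x
    obtain ⟨N, rfl⟩ := exists_mk x
    by_cases hN : mk N ∈ G
    · simp only [Set.mem_preimage, Set.mem_union, Set.mem_inter_iff, hN, true_and,
        Set.mem_compl_iff, not_true, false_and, or_false, Set.mem_iUnion, exists_prop]
      constructor
      · exact fun hs => ⟨N, ⟨hN, hs⟩,
          mk_mem_cyl.2 (BirootedNetwork.ballIso_of_equiv (Setoid.refl N) (ht N hN))⟩
      · rintro ⟨N', ⟨hN', hs⟩, hc⟩
        rwa [ht' N' hN' N hN (mk_mem_cyl.1 hc)]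
    · simp [hN, h0 _ hN]
  rw [hg]
  refine (hG.inter (IsOpen.measurableSet ?_)).union (hG.compl.inter (.const _))
  exact isOpen_biUnion fun N _ => isOpen_cyl _ _

open Classical in
/-- The law of the weighted graph with two roots, given the graph. -/
noncomputable def linkKernel (D : ℕ) (x : GStarStar Unit) : Measure (GStarStar ℤ) :=
  if IsGood D x then x.out.netLaw D else 0

instance (D : ℕ) (x : GStarStar Unit) : IsFiniteMeasure (linkKernel D x) := by
  unfold linkKernel
  split_ifs <;> infer_instance

theorem linkKernel_of_not {D : ℕ} {x : GStarStar Unit} (h : ¬IsGood D x) : linkKernel D x = 0 :=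
  if_neg h

/-- Independence of the representative: isomorphic graphs have isomorphic balls of every radius, so
locality identifies the two laws on all cylinders. -/
theorem linkKernel_mk {D : ℕ} {N : BirootedNetwork Unit} (hN : N.IsGood D) :
    linkKernel D (mk N) = N.netLaw D := by
  rw [linkKernel, if_pos (isGood_mk.2 hN)]
  have hequiv : (mk N).out ≈ N := Quotient.mk_out N
  have hN' : (mk N).out.IsGood D := by
    obtain ⟨e, he, -⟩ := Setoid.symm hequiv
    exact he.isGood hN
  refine ext_of_generate_finite (cyls ℤ) generateFrom_cyls isPiSystem_cyls ?_ (by simp)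
  rintro _ ⟨t, N₀, rfl⟩
  have := BirootedNetwork.ballIso_of_equiv
    (t := max (t + 1) (N.graph.dist N.root N.root')) (Setoid.symm hequiv)
    (N.mem_ball.2 (le_max_right _ _))
  exact BirootedNetwork.netLaw_cyl_eq hN' hN (le_max_left _ _) this.symm N₀

theorem measurable_linkKernel (D : ℕ) : Measurable (linkKernel D) := by
  refine .measure_of_isPiSystem generateFrom_cyls isPiSystem_cyls ?_ ?_
  · rintro _ ⟨t, N₀, rfl⟩
    refine measurable_of_local_on (measurableSet_isGood D) (c := 0)
      (fun x hx => by rw [linkKernel_of_not hx]; rfl) fun N hN =>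
        ⟨max (t + 1) (N.graph.dist N.root N.root'), N.mem_ball.2 (le_max_right _ _), fun N' hN' h => ?_⟩
    rw [linkKernel_mk hN, linkKernel_mk hN']
    exact BirootedNetwork.netLaw_cyl_eq hN' hN (le_max_left _ _) h N₀
  · refine measurable_of_local_on (measurableSet_isGood D) (c := 0)
      (fun x hx => by rw [linkKernel_of_not hx]; rfl) fun N hN =>
        ⟨N.graph.dist N.root N.root', N.mem_ball.2 le_rfl, fun N' hN' h => ?_⟩
    rw [linkKernel_mk hN, linkKernel_mk hN', measure_univ, measure_univ]

theorem lintegral_linkKernel {D : ℕ} {N : BirootedNetwork Unit} (hN : N.IsGood D)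
    {f : GStarStar ℤ → ℝ≥0∞} (hf : Measurable f) :
    ∫⁻ y, f y ∂linkKernel D (mk N) = ∫⁻ C, f (mk (N.withLinks C)) ∂N.linkLaw D N.root := by
  rw [linkKernel_mk hN, BirootedNetwork.netLaw, lintegral_map hf N.measurable_mk_withLinks]

end GStarStar

/-! ### Unimodularity of the randomly weighted graph -/

namespace RootedNetwork

/-- The rooted graph, weighted by the links. -/
noncomputable def withLinks (N : RootedNetwork Unit) (C : N.V → Finset N.V) : RootedNetwork ℤ :=
  ⟨N.toNetwork.withLinks C, N.root⟩

theorem measurable_mk_withLinks (N : RootedNetwork Unit) :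
    Measurable fun C => GStar.mk (N.withLinks C) :=
  GStarStar.continuous_fst.measurable.comp N.diag.measurable_mk_withLinks

end RootedNetwork

namespace GStar

/-- The law of the rooted weighted graph, given the graph. -/
noncomputable def linkKernel (D : ℕ) (x : GStar Unit) : Measure (GStar ℤ) :=
  (GStarStar.linkKernel D (diag x)).map GStarStar.fst

theorem measurable_linkKernel (D : ℕ) : Measurable (linkKernel D) :=
  (Measure.measurable_map _ GStarStar.continuous_fst.measurable).comp
    ((GStarStar.measurable_linkKernel D).comp continuous_diag.measurable)

theorem linkKernel_mk {D : ℕ} {N : RootedNetwork Unit} (hN : N.IsGood D) :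
    linkKernel D (mk N) = (N.linkLaw D N.root).map fun C => mk (N.withLinks C) := by
  have hN' : N.diag.IsGood D := hN
  rw [linkKernel, diag_mk, GStarStar.linkKernel_mk hN', BirootedNetwork.netLaw,
    Measure.map_map GStarStar.continuous_fst.measurable N.diag.measurable_mk_withLinks]
  rfl

theorem lintegral_linkKernel {D : ℕ} {N : RootedNetwork Unit} (hN : N.IsGood D)
    {f : GStar ℤ → ℝ≥0∞} (hf : Measurable f) :
    ∫⁻ y, f y ∂linkKernel D (mk N) = ∫⁻ C, f (mk (N.withLinks C)) ∂N.linkLaw D N.root := by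
  rw [linkKernel_mk hN, lintegral_map hf N.measurable_mk_withLinks]

/-- The law of the rooted graph, weighted by the random links. -/
noncomputable def linkMeasure (D : ℕ) (ρ : Measure (GStar Unit)) : Measure (GStar ℤ) :=
  ρ.bind (linkKernel D)

variable {D : ℕ} {ρ : Measure (GStar Unit)}

theorem lintegral_massOut_linkKernel {N : RootedNetwork Unit} (hN : N.IsGood D)
    {f : GStarStar ℤ → ℝ≥0∞} (hf : Measurable f) :
    ∫⁻ y, massOut f y ∂linkKernel D (mk N) =
      massOut (fun x => ∫⁻ y, f y ∂GStarStar.linkKernel D x) (mk N) := by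
  rw [lintegral_linkKernel hN (measurable_massOut hf), massOut_mk]
  have h : ∀ v : N.V, ∫⁻ y, f y ∂GStarStar.linkKernel D (.mk ⟨N.toNetwork, N.root, v⟩) =
      ∫⁻ C, f (.mk ((⟨N.toNetwork, N.root, v⟩ : BirootedNetwork Unit).withLinks C))
        ∂N.linkLaw D N.root := fun v => GStarStar.lintegral_linkKernel hN hf
  simp_rw [h]
  have h' := lintegral_tsum (μ := N.linkLaw D N.root)
    (f := fun (v : N.V) C => f (.mk ((⟨N.toNetwork, N.root, v⟩ : BirootedNetwork Unit).withLinks C)))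
    fun v => (hf.comp
      (BirootedNetwork.measurable_mk_withLinks ⟨N.toNetwork, N.root, v⟩)).aemeasurable
  exact h'

/-- Here root independence is indispensable: the kernel at `(v, root)` explores from `v`, whereas
the left side uses a single exploration from the root. For `massOut` both start at the root. -/
theorem lintegral_massIn_linkKernel {N : RootedNetwork Unit} (hN : N.IsGood D)
    {f : GStarStar ℤ → ℝ≥0∞} (hf : Measurable f) :
    ∫⁻ y, massIn f y ∂linkKernel D (mk N) =
      massIn (fun x => ∫⁻ y, f y ∂GStarStar.linkKernel D x) (mk N) := by
  rw [lintegral_linkKernel hN (measurable_massIn hf), massIn_mk]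
  have h : ∀ v : N.V, ∫⁻ y, f y ∂GStarStar.linkKernel D (.mk ⟨N.toNetwork, v, N.root⟩) =
      ∫⁻ C, f (.mk ((⟨N.toNetwork, v, N.root⟩ : BirootedNetwork Unit).withLinks C))
        ∂N.linkLaw D N.root := fun v => by
    rw [hN.linkLaw_eq N.root v]
    exact GStarStar.lintegral_linkKernel hN hf
  simp_rw [h]
  have h' := lintegral_tsum (μ := N.linkLaw D N.root)
    (f := fun (v : N.V) C => f (.mk ((⟨N.toNetwork, v, N.root⟩ : BirootedNetwork Unit).withLinks C)))
    fun v => (hf.comp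
      (BirootedNetwork.measurable_mk_withLinks ⟨N.toNetwork, v, N.root⟩)).aemeasurable
  exact h'

theorem lintegral_linkMeasure {f : GStar ℤ → ℝ≥0∞} (hf : Measurable f) :
    ∫⁻ y, f y ∂linkMeasure D ρ = ∫⁻ x, ∫⁻ y, f y ∂linkKernel D x ∂ρ :=
  Measure.lintegral_bind (measurable_linkKernel D).aemeasurable hf.aemeasurable

theorem linkMeasure_apply {s : Set (GStar ℤ)} (hs : MeasurableSet s) :
    linkMeasure D ρ s = ∫⁻ x, linkKernel D x s ∂ρ :=
  Measure.bind_apply hs (measurable_linkKernel D).aemeasurable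

theorem linkKernel_apply {N : RootedNetwork Unit} (hN : N.IsGood D) {s : Set (GStar ℤ)}
    (hs : MeasurableSet s) :
    linkKernel D (mk N) s = N.linkLaw D N.root {C | mk (N.withLinks C) ∈ s} := by
  rw [linkKernel_mk hN, Measure.map_apply N.measurable_mk_withLinks hs]
  rfl

theorem isUnimodular_linkMeasure (hρ : IsUnimodular ρ)
    (hgood : ∀ᵐ x ∂ρ, GStarStar.IsGood D (diag x)) : IsUnimodular (linkMeasure D ρ) := by
  have := hρ.1
  refine ⟨⟨?_⟩, fun f hf => ?_⟩
  · rw [linkMeasure_apply .univ, lintegral_congr_ae (g := fun _ => 1), lintegral_one, measure_univ]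
    filter_upwards [hgood] with x hx
    obtain ⟨N, rfl⟩ := exists_mk x
    rw [linkKernel_apply hx .univ]
    simp
  · have hF : Measurable fun x => ∫⁻ y, f y ∂GStarStar.linkKernel D x :=
      (Measure.measurable_lintegral hf).comp (GStarStar.measurable_linkKernel D)
    rw [lintegral_linkMeasure (measurable_massOut hf), lintegral_linkMeasure (measurable_massIn hf)]
    have h1 : ∀ᵐ x ∂ρ, ∫⁻ y, massOut f y ∂linkKernel D x =
        massOut (fun x => ∫⁻ y, f y ∂GStarStar.linkKernel D x) x := by
      filter_upwards [hgood] with x hx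
      obtain ⟨N, rfl⟩ := exists_mk x
      exact lintegral_massOut_linkKernel hx hf
    have h2 : ∀ᵐ x ∂ρ, ∫⁻ y, massIn f y ∂linkKernel D x =
        massIn (fun x => ∫⁻ y, f y ∂GStarStar.linkKernel D x) x := by
      filter_upwards [hgood] with x hx
      obtain ⟨N, rfl⟩ := exists_mk x
      exact lintegral_massIn_linkKernel hx hf
    rw [lintegral_congr_ae h1, lintegral_congr_ae h2]
    -- The mass transport principle of `ρ`, applied to `f` averaged over the links.
    exact hρ.2 _ hF

theorem forget_mk_withLinks (N : RootedNetwork Unit) (C : N.V → Finset N.V) :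
    forget (mk (N.withLinks C)) = mk N :=
  Quotient.sound ⟨Equiv.refl _, ⟨fun _ _ => Iff.rfl, fun _ _ => rfl⟩, rfl⟩

theorem measurePreserving_forget (hgood : ∀ᵐ x ∂ρ, GStarStar.IsGood D (diag x)) :
    MeasurePreserving forget (linkMeasure D ρ) ρ := by
  refine ⟨continuous_forget.measurable, Measure.ext fun s hs => ?_⟩
  have hs' := (continuous_forget (M := ℤ)).measurable hs
  rw [Measure.map_apply continuous_forget.measurable hs, linkMeasure_apply hs',
    ← lintegral_indicator_one hs]
  refine lintegral_congr_ae ?_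
  filter_upwards [hgood] with x hx
  obtain ⟨N, rfl⟩ := exists_mk x
  rw [linkKernel_apply hx hs']
  simp only [Set.mem_preimage, forget_mk_withLinks]
  by_cases h : mk N ∈ s <;> simp [h]

end GStar

/-! ### The line ensemble property and the density -/

namespace Network

theorem IsBallIso.finsum_weight_eq {N N' : Network ℤ} {o : N.V} {o' : N'.V} {R : ℕ}
    {e : N.ball o R ≃ N'.ball o' R} (he : IsBallIso e) (v : N.ball o R)
    (hv : N.graph.dist o v + 1 ≤ R) : ∑ᶠ u, N.weight u v = ∑ᶠ u, N'.weight u (e v) := by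
  have key : ∀ (P : Network ℤ) (p : P.V) (w : P.ball p R), P.graph.dist p w + 1 ≤ R →
      ∑ᶠ u, P.weight u w = ∑ᶠ u : P.ball p R, P.weight u w := by
    intro P p w hw
    rw [finsum_set_coe_eq_finsum_mem (f := fun u => P.weight u w), finsum_mem_def,
      Set.indicator_eq_self.2]
    intro u hu
    by_cases huw : u = w
    · exact huw ▸ w.2
    · have : P.graph.Adj u w := by
        by_contra h
        exact hu (P.weight_eq_zero _ _ huw h)
      exact P.ball_mono p hw (P.mem_ball_succ_of_adj (P.mem_ball.2 le_rfl) this.symm)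
  rw [key N o v hv, key N' o' (e v) (by rwa [he.dist_root]), ← finsum_comp_equiv e]
  exact finsum_congr fun u => he.induced.2 u v

theorem isLineEnsemble_of_forall_ballIso {N : Network ℤ} {o : N.V}
    (h : ∀ R, ∃ (N' : Network ℤ) (o' : N'.V) (e : N.ball o R ≃ N'.ball o' R), IsBallIso e ∧
      N'.IsLineEnsemble) : N.IsLineEnsemble := by
  refine ⟨fun u v => ?_, fun u v => ?_, fun u => ?_, fun v => ?_⟩
  · obtain ⟨N', o', e, he, hN'⟩ := h (max (N.graph.dist o u) (N.graph.dist o v))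
    have h1 := he.induced.2 ⟨u, N.mem_ball.2 (le_max_left _ _)⟩ ⟨v, N.mem_ball.2 (le_max_right _ _)⟩
    rw [h1]
    exact hN'.1 _ _
  · obtain ⟨N', o', e, he, hN'⟩ := h (max (N.graph.dist o u) (N.graph.dist o v))
    have h1 := he.induced.2 ⟨u, N.mem_ball.2 (le_max_left _ _)⟩ ⟨v, N.mem_ball.2 (le_max_right _ _)⟩
    have h2 := he.induced.2 ⟨v, N.mem_ball.2 (le_max_right _ _)⟩ ⟨u, N.mem_ball.2 (le_max_left _ _)⟩
    rw [h1, h2]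
    exact hN'.2.1 _ _
  · obtain ⟨N', o', e, he, hN'⟩ := h (N.graph.dist o u)
    have h1 := he.induced.2 ⟨u, N.mem_ball.2 le_rfl⟩ ⟨u, N.mem_ball.2 le_rfl⟩
    rw [h1]
    exact hN'.2.2.1 _
  · obtain ⟨N', o', e, he, hN'⟩ := h (N.graph.dist o v + 1)
    have h1 := he.finsum_weight_eq ⟨v, N.mem_ball.2 (Nat.le_succ _)⟩ le_rfl
    rw [h1]
    exact hN'.2.2.2 _

/-- Each vertex chooses no neighbour or two neighbours, and edges are chosen by both endpoints or
by none. -/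
structure IsConsistent (N : Network Unit) (C : N.V → Finset N.V) : Prop where
  subset_nbr : ∀ v, C v ⊆ N.nbr v
  card : ∀ v, (C v).card = 0 ∨ (C v).card = 2
  mem_iff : ∀ v w, N.graph.Adj v w → (v ∈ C w ↔ w ∈ C v)

theorem IsGood.ae_isConsistent {N : Network Unit} {D : ℕ} (hN : N.IsGood D) (o : N.V) :
    ∀ᵐ C ∂N.linkLaw D o, N.IsConsistent C := by
  filter_upwards [hN.ae_pairWeight_ne_zero o, hN.ae_mem_iff o] with C h1 h2
  have hsub := fun v => subset_nbr_of_pairWeight_ne_zero (h1 v)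
  refine ⟨hsub, fun v => ?_, h2⟩
  have := h1 v
  rw [pairWeight, if_pos (hsub v)] at this
  split_ifs at this with h3 h4
  · exact Or.inl h3
  · exact Or.inr h4
  · exact absurd rfl this

theorem IsConsistent.isLink_iff {N : Network Unit} {C : N.V → Finset N.V} (h : N.IsConsistent C)
    {u v : N.V} : N.IsLink C u v ↔ u ∈ C v := by
  refine ⟨fun h' => h'.2.1, fun h' => ?_⟩
  have hadj : N.graph.Adj u v := (mem_nbr.1 (h.subset_nbr v h')).symm
  exact ⟨hadj, h', (h.mem_iff u v hadj).1 h'⟩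

theorem weight_withLinks_eq_one_iff {N : Network Unit} {C : N.V → Finset N.V} {u v : N.V} :
    (N.withLinks C).weight u v = 1 ↔ N.IsLink C u v := by
  classical
  change (if N.IsLink C u v then (1 : ℤ) else 0) = 1 ↔ _
  split_ifs with h <;> simp [h]

open Classical in
theorem IsConsistent.weight_withLinks {N : Network Unit} {C : N.V → Finset N.V}
    (h : N.IsConsistent C) (u v : N.V) :
    (N.withLinks C).weight u v = if u ∈ C v then 1 else 0 := by
  by_cases hu : u ∈ C v
  · rw [if_pos hu]
    exact if_pos (h.isLink_iff.2 hu)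
  · rw [if_neg hu]
    exact if_neg (h.isLink_iff.not.2 hu)

theorem IsConsistent.isLineEnsemble {N : Network Unit} {C : N.V → Finset N.V}
    (h : N.IsConsistent C) : (N.withLinks C).IsLineEnsemble := by
  classical
  have hself : ∀ u, u ∉ C u := fun u hu => N.graph.loopless.irrefl u (mem_nbr.1 (h.subset_nbr u hu))
  refine ⟨fun (u v : N.V) => ?_, fun (u v : N.V) => ?_, fun (u : N.V) => ?_, fun (v : N.V) => ?_⟩
  · rw [h.weight_withLinks]
    split_ifs <;> simp
  · have : u ∈ C v ↔ v ∈ C u := by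
      rw [← h.isLink_iff, ← h.isLink_iff]
      exact ⟨fun h => ⟨h.1.symm, h.2.2, h.2.1⟩, fun h => ⟨h.1.symm, h.2.2, h.2.1⟩⟩
    simp only [h.weight_withLinks, this]
  · rw [h.weight_withLinks, if_neg (hself u)]
  · have : (∑ᶠ u : N.V, (N.withLinks C).weight u v) = (C v).card := by
      rw [finsum_congr fun u => h.weight_withLinks u v,
        finsum_eq_sum_of_support_subset (s := C v) _ (fun u hu => by simpa using hu)]
      simp
    change (∑ᶠ u : N.V, (N.withLinks C).weight u v) = 0 ∨
      (∑ᶠ u : N.V, (N.withLinks C).weight u v) = 2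
    rw [this]
    exact_mod_cast h.card v

end Network

namespace GStar

/-- The set is closed: each condition concerns the weights near one or two vertices, so it can be
checked in balls. -/
theorem measurableSet_isLineEnsemble : MeasurableSet {x : GStar ℤ | IsLineEnsemble x} := by
  rw [← MeasurableSet.compl_iff]
  refine (isOpen_of_local fun N hN => ?_).measurableSet
  by_contra! h
  refine hN (Network.isLineEnsemble_of_forall_ballIso (o := N.root) fun R => ?_)
  obtain ⟨N', h1, h2⟩ := h R
  obtain ⟨e, he⟩ := RootedNetwork.ballIso_iff.1 h1.symm
  exact ⟨N'.toNetwork, N'.root, e, he, not_not.1 h2⟩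

theorem rootMem_of_ballIso {N N' : RootedNetwork ℤ} (h : N.BallIso 1 N')
    (hN : RootMem (mk N)) : RootMem (mk N') := by
  obtain ⟨e, he⟩ := RootedNetwork.ballIso_iff.1 h
  obtain ⟨u, hu⟩ := hN
  have hub : u ∈ N.toNetwork.ball N.root 1 := by
    -- A general network may carry a weight on the diagonal, so `u` may be the root itself.
    by_cases huw : u = N.root
    · exact huw ▸ N.self_mem_ball _ _
    · have : N.graph.Adj u N.root := by
        by_contra h
        rw [N.weight_eq_zero _ _ huw h] at hu
        exact zero_ne_one hu
      exact (SimpleGraph.dist_eq_one_iff_adj.2 this.symm).le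
  refine ⟨e ⟨u, hub⟩, ?_⟩
  have h1 := he.induced.2 ⟨u, hub⟩ ⟨N.root, N.self_mem_ball _ _⟩
  rw [he.root] at h1
  exact h1.symm.trans hu

theorem measurableSet_rootMem : MeasurableSet {x : GStar ℤ | RootMem x} :=
  (isOpen_of_local fun _ hN => ⟨1, fun _ h => rootMem_of_ballIso h.symm hN⟩).measurableSet

theorem measurable_rootDegree : Measurable (rootDegree : GStar Unit → ℕ) := by
  refine measurable_of_local fun N => ⟨1, fun N' h => ?_⟩
  obtain ⟨e, he⟩ := RootedNetwork.ballIso_iff.1 h.symm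
  have h1 := he.degree_eq ⟨N.root, N.self_mem_ball _ _⟩ (by simp)
  rw [he.root] at h1
  exact h1

variable {D : ℕ} {ρ : Measure (GStar Unit)}

theorem ae_isLineEnsemble_linkMeasure (hgood : ∀ᵐ x ∂ρ, GStarStar.IsGood D (diag x)) :
    ∀ᵐ y ∂linkMeasure D ρ, IsLineEnsemble y := by
  have hm := measurableSet_isLineEnsemble.compl
  change linkMeasure D ρ {y | IsLineEnsemble y}ᶜ = 0
  rw [linkMeasure_apply hm, lintegral_congr_ae (g := fun _ => 0), lintegral_zero]
  filter_upwards [hgood] with x hx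
  obtain ⟨N, rfl⟩ := exists_mk x
  rw [linkKernel_apply hx hm]
  have h : ∀ᵐ C ∂N.linkLaw D N.root, ¬ (mk (N.withLinks C) ∈ {y | IsLineEnsemble y}ᶜ) := by
    filter_upwards [Network.IsGood.ae_isConsistent hx N.root] with C hC
    exact not_not.2 hC.isLineEnsemble
  simpa [ae_iff] using h

theorem linkKernel_rootMem {N : RootedNetwork Unit} (hN : N.IsGood D) :
    linkKernel D (mk N) {y | RootMem y} = ENNReal.ofReal (rootDegree (mk N) / D) := by
  rw [linkKernel_apply hN measurableSet_rootMem]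
  refine Eq.trans (measure_congr ?_) (hN.linkLaw_nonempty N.root N.root)
  filter_upwards [hN.ae_isConsistent N.root] with C hC
  refine propext ?_
  change (∃ u : N.V, (N.withLinks C).weight u N.root = 1) ↔ (C N.root).Nonempty
  exact exists_congr fun u => Network.weight_withLinks_eq_one_iff.trans hC.isLink_iff

theorem density_linkMeasure (hgood : ∀ᵐ x ∂ρ, GStarStar.IsGood D (diag x)) :
    density (linkMeasure D ρ) = (∫ x, (rootDegree x : ℝ) ∂ρ) / D := by
  rw [density, measureReal_def, linkMeasure_apply measurableSet_rootMem,
    lintegral_congr_ae (g := fun x => ENNReal.ofReal (rootDegree x / D)), ← integral_div,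
    integral_eq_lintegral_of_nonneg_ae (.of_forall fun x => by positivity)]
  · exact ((measurable_from_top.comp measurable_rootDegree).div_const _).aestronglyMeasurable
  · filter_upwards [hgood] with x hx
    obtain ⟨N, rfl⟩ := exists_mk x
    exact linkKernel_rootMem hx

theorem isInvariantLineEnsemble_linkMeasure (hρ : IsUnimodular ρ)
    (hgood : ∀ᵐ x ∂ρ, GStarStar.IsGood D (diag x)) :
    IsInvariantLineEnsemble ρ (linkMeasure D ρ) :=
  ⟨isUnimodular_linkMeasure hρ hgood, measurePreserving_forget hgood,
    ae_isLineEnsemble_linkMeasure hgood⟩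

end GStar

theorem mainTheorem11 (d : ℕ) (ρ : MeasureTheory.Measure (GStar Unit))
    (hρ : GStar.IsUnimodular ρ)
    (htree : ∀ᵐ x ∂ρ, GStar.IsTree x)
    (hdeg : ∀ᵐ x ∂ρ, GStar.DegreesIn 2 d x) :
    ∃ σ : MeasureTheory.Measure (GStar ℤ),
      GStar.IsInvariantLineEnsemble ρ σ ∧
      1 / 3 * (∫ x, (GStar.rootDegree x : ℝ) ∂ρ) / (d : ℝ) ≤ GStar.density σ ∧
      (6 ≤ d →
        1 / 3 * (∫ x, (GStar.rootDegree x : ℝ) ∂ρ) / ((d : ℝ) - 4) ≤ GStar.density σ) := by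
  have := hρ.1
  have hgood : ∀ᵐ x ∂ρ, GStarStar.IsGood (max d 3) (GStar.diag x) := by
    filter_upwards [htree, hdeg] with x h1 h2
    obtain ⟨N, rfl⟩ := GStar.exists_mk x
    exact ⟨h1, fun v => ⟨(h2 v).1, (h2 v).2.trans (le_max_left _ _)⟩, le_max_right _ _⟩
  have hd : 2 ≤ d := by
    obtain ⟨x, hx⟩ := hdeg.exists
    obtain ⟨N, rfl⟩ := GStar.exists_mk x
    exact (hx N.root).1.trans (hx N.root).2
  have hI : 0 ≤ ∫ x, (GStar.rootDegree x : ℝ) ∂ρ := integral_nonneg fun x => by positivity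
  refine ⟨GStar.linkMeasure (max d 3) ρ, GStar.isInvariantLineEnsemble_linkMeasure hρ hgood, ?_,
    fun h6 => ?_⟩
  all_goals
    rw [GStar.density_linkMeasure hgood, mul_comm, mul_one_div, div_div]
    refine div_le_div_of_nonneg_left hI (by positivity) ?_
  -- Here `3 * d` covers the case `d = 2`, where the construction runs with `D = 3`.
  · have : max d 3 ≤ 3 * d := by omega
    exact_mod_cast this
  -- The remaining inequality `d ≤ 3 * (d - 4)` is equivalent to `d ≥ 6`.
  · have h6' : (6 : ℝ) ≤ d := by exact_mod_cast h6
    rw [max_eq_left (by omega)]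
    linarith
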